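/- **Setting.** Let $K$ be the doubled Kronecker quiver: two vertices $s,t$, arrows $a,b:s\to t$ and $a',b':t\to s$, with relations $b'a=a'b$ and $ba'=ab'$. Let $\mathrm{mod}^{nil}K$ be the category of its finite-dimensional nilpotent complex representations, $S_s,S_t$ the simple representations, and, for $y=[y_0:y_1]\in\mathbb P^1$, let $R_y$ be the representation with a copy of $\mathbb C$ at each vertex, $a=y_0$, $b=y_1$, $a'=b'=0$. Let $i:\mathbb P^1\to T^*\mathbb P^1$ be the zero section. We consider $\mathrm{mod}^{nil}K$ as the heart of a bounded t-structure on $D^b_{\mathbb P^1}(\mathrm{Coh}\,T^*\mathbb P^1)$ such that $S_t$, $S_s$, $R_y$ correspond to $i_*\mathcal O_{\mathbb P^1}(-1)$, $i_*\mathcal O_{\mathbb P^1}(-2)[1]$, $i_*\mathcal O_y$. A stability condition $\sigma$ on this heart $\mathcal A$ of the triangulated category $\mathcal T$ consists of a homomorphism $Z:K(\mathcal T)\to\mathbb C$, a class of semistable objects $Q\in\mathcal A$, and phases $\phi_Q\in\mathbb R$, such that: $Z(Q)=m(Q)e^{i\phi_Q}$ with $m(Q)>0$; $|\phi_Q-\phi_{Q'}|<\pi$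 if $\mathrm{Hom}(Q,Q'[1])\ne0$; $\mathrm{Hom}(Q',Q)=0$ if $\phi_{Q'}>\phi_Q$; and each nonzero object of $\mathcal A$ has a Harder–Narasimhan filtration. It is a *Bridgeland* stability condition if all phases of semistable objects lie in one half-open interval $(\theta,\theta+\pi]$. For $\phi\in\mathbb R$ let $\mathcal A^\sigma_\phi\subset\mathcal T$ be the tilted heart, the extension-closed full subcategory generated by the semistable $Q$ with $\phi_Q>\phi$ and by $Q[1]$ for the semistable $Q$ with $\phi_Q\le\phi$. There is a *wall-crossing of the second kind* between $\sigma$ and $\sigma'$ if they have the same semistable objects with the same order of phases, and there are $\phi\in\mathbb R$ and a semistable object $Q$ such that $\phi$ lies strictly between $\phi^\sigma_Q$ and $\phi^{\sigma'}_Q$, and $\mathcal A^{\sigma}_\phi\neq\mathcal A^{\sigma'}_\phi$. For $a_1+a_2W+a_3W^2$ with $a_2,a_3\neq0$ and roots $\beta_0,\beta_1\ne0$, put $x=a_1a_3/a_2^2$, $\varpi_0(x)=1$ and $\varpi_1(x)=\frac{\log\beta_0-\log\beta_1}{2\pi i}$, for any choice of the logarithms. The roots are labelled so that $|\beta_0|<|\beta_1|$,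 as is appropriate near the large complex structure limit $x=0$ (so that $\varpi_1(x)\sim\frac{\log x}{2\pi i}$); every $x$ with $0<|x|<\frac14$ occurs. The central charge $Z_x^{A_1}$ is given by $Z_x^{A_1}(i_*\mathcal O_y)=\varpi_0(x)$ for $y\in\mathbb P^1$ and $Z_x^{A_1}(i_*\mathcal O_{\mathbb P^1}(-1))=\varpi_1(x)$. **Proposition.** 1. There is a family of Bridgeland stability conditions on $\mathrm{mod}^{nil}K$ with central charges $Z_x^{A_1}$, one for each value of $x$ and each branch of $\varpi_1$ as above, with the phase of each semistable object $Q$ equal to $\arg Z_x^{A_1}(Q)\in(-\pi,\pi]$. The family depends continuously on $\varpi_1$: as $\varpi_1$ varies, the phases $\phi_Q$ and the $\log m(Q)$ vary continuously, uniformly in the semistable objects $Q$. 2. Whenever two of these periods take different values, $\varpi_1(x)\ne\varpi_1(x')$, there is a wall-crossing of the second kind between any Bridgeland stability conditions $\sigma,\sigma'$ on $\mathrm{mod}^{nil}K$ with central charges $Z_x^{A_1}$ and $Z_{x'}^{A_1}$. It is not one of dilation and rotation: there are no $r>0$, $\theta\in\mathbb R$ with $Z_{x'}^{A_1}=re^{i\theta}Z_x^{A_1}$,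 and there is no $\theta\in\mathbb R$ with $\mathcal A^{\sigma'}_{\phi+\theta}=\mathcal A^{\sigma}_{\phi}$ for all $\phi\in\mathbb R$. The same holds for every triangulated category with a bounded t-structure whose heart is identified with $\mathrm{mod}^{nil}K$, with $R_y$ and $S_t$ in place of $i_*\mathcal O_y$ and $i_*\mathcal O_{\mathbb P^1}(-1)$. -/

import Mathlib

open ZeroObject CategoryTheory Limits AlgebraicGeometry Pretriangulated
open CategoryTheory.Triangulated (TStructure)

universe w v u

noncomputable section

section Stability

variable (C : Type u) [Category.{v} C] [Preadditive C] [HasZeroObject C] [HasShift C ℤ]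
  [∀ n : ℤ, (shiftFunctor C n).Additive] [Pretriangulated C]

/-- The Grothendieck group of a triangulated category: the free abelian group on the objects,
modulo `[Y] = [X] + [Z]` for every distinguished triangle `X → Y → Z → X[1]`. -/
def TriangulatedK0 : Type u :=
  FreeAbelianGroup C ⧸ AddSubgroup.closure
    {x : FreeAbelianGroup C | ∃ T ∈ distTriang C, x = FreeAbelianGroup.of T.obj₂ -
      (FreeAbelianGroup.of T.obj₁ + FreeAbelianGroup.of T.obj₃)}

instance : AddCommGroup (TriangulatedK0 C) :=
  inferInstanceAs (AddCommGroup (FreeAbelianGroup C ⧸ AddSubgroup.closure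
    {x : FreeAbelianGroup C | ∃ T ∈ distTriang C, x = FreeAbelianGroup.of T.obj₂ -
      (FreeAbelianGroup.of T.obj₁ + FreeAbelianGroup.of T.obj₃)}))

variable {C}

/-- The class of an object in the Grothendieck group. -/
def k0Class (X : C) : TriangulatedK0 C :=
  QuotientAddGroup.mk (FreeAbelianGroup.of X)

/-- The extension-closed full subcategory generated by a family of objects. -/
inductive ExtensionClosure (P : ObjectProperty C) : C → Prop
  | zero (X : C) (hX : IsZero X) : ExtensionClosure P X
  | of (X : C) (hX : P X) : ExtensionClosure P X
  | extension (T : Triangle C) (hT : T ∈ distTriang C) (h₁ : ExtensionClosure P T.obj₁)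
      (h₃ : ExtensionClosure P T.obj₃) : ExtensionClosure P T.obj₂

/-- A Harder-Narasimhan filtration `0 = Fₙ ⊂ ⋯ ⊂ F₁ ⊂ F₀ = E` of an object `E` of the heart by short exact
sequences `0 → Fᵢ₊₁ → Fᵢ → Qᵢ → 0` in the heart (that is, distinguished triangles with vertices in the
heart) with semistable `Qᵢ` of increasing phases. -/
structure HNFiltration (t : TStructure C) (semistable : ObjectProperty C) (phase : C → ℝ)
    (E : C) where
  length : ℕ
  F : ℕ → C
  factor : ℕ → C
  F_zero : F 0 = E
  isZero_F_length : IsZero (F length)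
  heart_F (i : ℕ) : i ≤ length → t.heart (F i)
  semistable_factor (i : ℕ) : i < length → semistable (factor i)
  shortExact (i : ℕ) : i < length → ∃ (f : F (i + 1) ⟶ F i) (g : F i ⟶ factor i)
    (h : factor i ⟶ (F (i + 1))⟦(1 : ℤ)⟧), Triangle.mk f g h ∈ distTriang C
  phase_lt (i : ℕ) : i + 1 < length → phase (factor i) < phase (factor (i + 1))

/-- A stability condition on the heart of the t-structure `t`: a central charge on the Grothendieck group
of the triangulated category, semistable objects of the heart and their phases (in radians). -/
structure StabilityCondition (t : TStructure C) where
  Z : TriangulatedK0 C →+ ℂ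
  semistable : ObjectProperty C
  phase : C → ℝ
  semistable_of_iso {X Y : C} (e : X ≅ Y) : semistable X → semistable Y
  heart_of_semistable (Q : C) : semistable Q → t.heart Q
  charge (Q : C) : semistable Q →
    ∃ m : ℝ, 0 < m ∧ Z (k0Class Q) = m * Complex.exp (phase Q * Complex.I)
  phase_sub_lt (Q Q' : C) : semistable Q → semistable Q' →
    (∃ f : Q ⟶ Q'⟦(1 : ℤ)⟧, f ≠ 0) → |phase Q - phase Q'| < Real.pi
  hom_eq_zero (Q' Q : C) : semistable Q' → semistable Q → phase Q < phase Q' →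
    ∀ f : Q' ⟶ Q, f = 0
  hn (E : C) : t.heart E → ¬ IsZero E → Nonempty (HNFiltration t semistable phase E)

namespace StabilityCondition

variable {t : TStructure C}

/-- The stability condition is one in the sense of Bridgeland: the phases of the semistable objects lie in
a half-open interval of length `π`.  Equivalently, up to the rotation by `-θ`, the central charges of the
nonzero objects of the heart lie in the union of the upper half-plane and the negative real axis, and
the phases are their arguments in `(0, π]`. -/
def IsBridgeland (σ : StabilityCondition t) : Prop :=
  ∃ θ : ℝ, ∀ Q, σ.semistable Q → σ.phase Q ∈ Set.Ioc θ (θ + Real.pi)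

/-- The tilted heart at `φ`: the extension-closed full subcategory generated by the semistable objects `Q`
of phase `> φ` and the shifts `Q[1]` of the semistable objects of phase `≤ φ`. -/
def tilt (σ : StabilityCondition t) (φ : ℝ) : ObjectProperty C :=
  ExtensionClosure fun X => (σ.semistable X ∧ φ < σ.phase X) ∨
    ∃ Q, σ.semistable Q ∧ σ.phase Q ≤ φ ∧ Nonempty (X ≅ Q⟦(1 : ℤ)⟧)

/-- The same semistable objects, with the same order of phases. -/
def SameOrder (σ σ' : StabilityCondition t) : Prop :=
  (∀ Q, σ.semistable Q ↔ σ'.semistable Q) ∧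
    ∀ Q₁ Q₂, σ.semistable Q₁ → σ.semistable Q₂ →
      (σ'.phase Q₁ < σ'.phase Q₂ ↔ σ.phase Q₁ < σ.phase Q₂)

/-- A wall-crossing of the second kind between `σ` and `σ'`: semistable objects and the order of their phases do
not change, but the phase of some semistable object crosses some `φ`, and the tilted hearts at `φ` differ. -/
def WallCrossingSecondKind (σ σ' : StabilityCondition t) : Prop :=
  SameOrder σ σ' ∧ ∃ (φ : ℝ) (Q : C), σ.semistable Q ∧
    ((σ.phase Q < φ ∧ φ < σ'.phase Q) ∨ (σ'.phase Q < φ ∧ φ < σ.phase Q)) ∧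
    σ.tilt φ ≠ σ'.tilt φ

/-- The central charges differ by a dilation and a rotation. -/
def ByDilationRotation (σ σ' : StabilityCondition t) : Prop :=
  ∃ r θ : ℝ, 0 < r ∧ ∀ x, σ'.Z x = r * Complex.exp (θ * Complex.I) * σ.Z x

/-- The tilted hearts are the same up to a shift of phases, as is the case after a dilation and a rotation. -/
def SameTiltsUpToRotation (σ σ' : StabilityCondition t) : Prop :=
  ∃ θ : ℝ, ∀ φ : ℝ, σ'.tilt (φ + θ) = σ.tilt φ

end StabilityCondition

end Stability

/-- A polynomial `a₁ + a₂ W + a₃ W²` with roots `β₀, β₁` and a choice of their logarithms.  The condition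
`|β₀| < |β₁|` labels the roots such that `β₀ / β₁ → 0` in the large complex structure limit `x → 0`, where
`ϖ₁(x)` is asymptotically `log x / (2πi)`. -/
structure A1Branch where
  a₁ : ℂ
  a₂ : ℂ
  a₃ : ℂ
  a₂_ne_zero : a₂ ≠ 0
  a₃_ne_zero : a₃ ≠ 0
  β₀ : ℂ
  β₁ : ℂ
  roots (W : ℂ) : a₁ + a₂ * W + a₃ * W ^ 2 = a₃ * (W - β₀) * (W - β₁)
  logβ₀ : ℂ
  logβ₁ : ℂ
  exp_logβ₀ : Complex.exp logβ₀ = β₀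
  exp_logβ₁ : Complex.exp logβ₁ = β₁
  norm_lt : ‖β₀‖ < ‖β₁‖

namespace A1Branch
/-- The parameter `x = a₁ a₃ / a₂²`. -/
def x (p : A1Branch) : ℂ := p.a₁ * p.a₃ / p.a₂ ^ 2
/-- The period `ϖ₀(x) = 1`. -/
def period₀ (_ : A1Branch) : ℂ := 1
/-- The value of the period `ϖ₁(x) = (log β₀ - log β₁) / (2πi)` on the chosen branch. -/
def period₁ (p : A1Branch) : ℂ := (p.logβ₀ - p.logβ₁) / (2 * Real.pi * Complex.I)
end A1Branch

namespace DoubledKronecker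
/-- The two vertices of the doubled Kronecker quiver `K`. -/
inductive Vertex : Type
  | s
  | t

/-- The arrows: `a, b : s → t` and the inverse arrows `a', b' : t → s`. -/
inductive Arrow : Vertex → Vertex → Type
  | a : Arrow Vertex.s Vertex.t
  | b : Arrow Vertex.s Vertex.t
  | a' : Arrow Vertex.t Vertex.s
  | b' : Arrow Vertex.t Vertex.s

instance : Quiver.{0} Vertex := ⟨Arrow⟩

/-- An arrow as a path of length one. -/
def arrow {v w : Vertex} (e : Arrow v w) :
    (Paths.of Vertex).obj v ⟶ (Paths.of Vertex).obj w := (Paths.of Vertex).map e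

/-- The commuting relations: `b' a = a' b` at `s` and `b a' = a b'` at `t` (paths are composed in
diagrammatic order in the code). -/
inductive Relation : HomRel (Paths Vertex)
  | source : Relation (arrow Arrow.a ≫ arrow Arrow.b') (arrow Arrow.b ≫ arrow Arrow.a')
  | target : Relation (arrow Arrow.a' ≫ arrow Arrow.b) (arrow Arrow.b' ≫ arrow Arrow.a)

/-- Representations of `K` with its relations. -/
abbrev Rep : Type 1 := CategoryTheory.Quotient Relation ⥤ ModuleCat.{0} ℂ

/-- The vector space of a representation at a vertex. -/
def Rep.space (M : Rep) (v : Vertex) : ModuleCat.{0} ℂ :=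
  M.obj ((Quotient.functor Relation).obj ((Paths.of Vertex).obj v))

/-- The action of a path. -/
def Rep.act (M : Rep) {v w : Vertex} (p : Quiver.Path v w) : M.space v ⟶ M.space w :=
  M.map ((Quotient.functor Relation).map p)

/-- Finite-dimensional representations on which all sufficiently long paths act by zero. -/
def IsNilpotentRep : ObjectProperty Rep := fun M =>
  (∀ v, FiniteDimensional ℂ (M.space v)) ∧
    ∃ n : ℕ, ∀ (v w : Vertex) (p : Quiver.Path v w), n ≤ p.length → M.act p = 0

/-- The category `mod^nil K` of nilpotent representations. -/
abbrev NilRep : Type 1 := IsNilpotentRep.FullSubcategory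

/-- Vector spaces at the vertices and linear maps on the arrows. -/
def mapsPrefunctor (V : Vertex → ModuleCat.{0} ℂ) (f : ∀ v w, Arrow v w → (V v ⟶ V w)) :
    Vertex ⥤q ModuleCat.{0} ℂ where
  obj := V
  map e := f _ _ e

/-- The representation given by linear maps that satisfy the relations. -/
def mkRep (V : Vertex → ModuleCat.{0} ℂ) (f : ∀ v w, Arrow v w → (V v ⟶ V w))
    (hs : f _ _ Arrow.a ≫ f _ _ Arrow.b' = f _ _ Arrow.b ≫ f _ _ Arrow.a')
    (ht : f _ _ Arrow.a' ≫ f _ _ Arrow.b = f _ _ Arrow.b' ≫ f _ _ Arrow.a) : Rep :=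
  CategoryTheory.Quotient.lift Relation (Paths.lift (mapsPrefunctor V f)) (by
    rintro _ _ _ _ (_ | _)
    · simp only [arrow, Paths.of_map]
      exact hs
    · simp only [arrow, Paths.of_map]
      exact ht)

/-- `ℂ` if the vertices agree and `0` otherwise. -/
def simpleSpace (v w : Vertex) : ModuleCat.{0} ℂ :=
  match v, w with
  | Vertex.s, Vertex.s => ModuleCat.of ℂ ℂ
  | Vertex.t, Vertex.t => ModuleCat.of ℂ ℂ
  | _, _ => ModuleCat.of ℂ PUnit.{1}

/-- The simple representation at a vertex, as a representation. -/
def simpleRep (v : Vertex) : Rep :=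
  mkRep (simpleSpace v) (fun _ _ _ => 0) (by simp) (by simp)

/-- `a, b` act as the scalars `y₀, y₁` and `a', b'` act by zero. -/
def pointMap (y : ℂ × ℂ) :
    ∀ v w, Arrow v w → (ModuleCat.of ℂ ℂ ⟶ ModuleCat.of ℂ ℂ)
  | _, _, Arrow.a => y.1 • 𝟙 (ModuleCat.of ℂ ℂ)
  | _, _, Arrow.b => y.2 • 𝟙 (ModuleCat.of ℂ ℂ)
  | _, _, Arrow.a' => 0
  | _, _, Arrow.b' => 0

lemma pointMap_comp (y : ℂ × ℂ) {u v w : Vertex} (e : Arrow u v) (e' : Arrow v w) :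
    pointMap y u v e ≫ pointMap y v w e' = 0 := by
  cases e <;> cases e' <;> simp [pointMap]

/-- The representation `ℂ ⇉ ℂ` with `a = y₀`, `b = y₁`, `a' = b' = 0`, as a representation. -/
def pointRep (y : ℂ × ℂ) : Rep :=
  mkRep (fun _ => ModuleCat.of ℂ ℂ) (pointMap y) (by simp [pointMap]) (by simp [pointMap])

lemma isNilpotentRep_simpleRep (v : Vertex) : IsNilpotentRep (simpleRep v) := by
  refine ⟨fun w => ?_, 1, fun u w p hp => ?_⟩
  · cases v <;> cases w
    · exact inferInstanceAs (FiniteDimensional ℂ ℂ)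
    · exact inferInstanceAs (FiniteDimensional ℂ PUnit.{1})
    · exact inferInstanceAs (FiniteDimensional ℂ PUnit.{1})
    · exact inferInstanceAs (FiniteDimensional ℂ ℂ)
  · cases p with
    | nil => simp at hp
    | cons q e => exact comp_zero (C := ModuleCat ℂ)

lemma isNilpotentRep_pointRep (y : ℂ × ℂ) : IsNilpotentRep (pointRep y) := by
  refine ⟨fun w => inferInstanceAs (FiniteDimensional ℂ ℂ), 2, fun u w p hp => ?_⟩
  cases p with
  | nil => simp at hp
  | cons q e =>
    cases q with
    | nil => simp at hp
    | cons r e' =>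
      refine (Category.assoc (obj := ModuleCat ℂ) _ (pointMap y _ _ e') (pointMap y _ _ e)).trans ?_
      rw [pointMap_comp]
      exact comp_zero (C := ModuleCat ℂ)

/-- The simple representation at a vertex. -/
def simple (v : Vertex) : NilRep := ⟨simpleRep v, isNilpotentRep_simpleRep v⟩
/-- The representation `R_y` of dimension vector `(1, 1)` with `a = y₀`, `b = y₁`, `a' = b' = 0`. -/
def pointObj (y : ℂ × ℂ) : NilRep := ⟨pointRep y, isNilpotentRep_pointRep y⟩
end DoubledKronecker

namespace A1Geometry

/-- The coordinate ring `ℂ[u, p]` of a standard chart of `T*ℙ¹`: `u = X 0` is the affine coordinate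
of `ℙ¹` and `p = X 1` the fibre coordinate. -/
abbrev Chart : Type := MvPolynomial (Fin 2) ℂ

/-- The coordinate ring `ℂ[u, u⁻¹, p]` of the overlap of the two charts. -/
abbrev Overlap : Type := Localization.Away (MvPolynomial.X 0 : Chart)

/-- The localization map `ℂ[u, p] → ℂ[u, u⁻¹, p]`. -/
def chartToOverlap : Chart →+* Overlap := algebraMap Chart Overlap

/-- The element `u⁻¹`. -/
def invCoord : Overlap := IsLocalization.Away.invSelf (MvPolynomial.X 0 : Chart)

lemma coord_mul_invCoord : chartToOverlap (MvPolynomial.X 0) * invCoord = 1 :=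
  IsLocalization.Away.mul_invSelf _

/-- The map `u ↦ u⁻¹`, `p ↦ -u² p`: since `d(u⁻¹) = -u⁻² du`, this is the transition of the
cotangent bundle. -/
def chartFlip : Chart →+* Overlap :=
  (MvPolynomial.aeval (R := ℂ) ![invCoord,
    -(chartToOverlap (MvPolynomial.X 0) ^ 2 * chartToOverlap (MvPolynomial.X 1))]).toRingHom

lemma isUnit_chartFlip : IsUnit (chartFlip (MvPolynomial.X 0)) := by
  refine IsUnit.of_mul_eq_one (chartToOverlap (MvPolynomial.X 0)) ?_
  simpa [chartFlip, mul_comm] using coord_mul_invCoord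

/-- The coordinate change `u ↦ u⁻¹`, `p ↦ -u² p` of the overlap; it is an involution. -/
def flip : Overlap →+* Overlap :=
  IsLocalization.Away.lift (MvPolynomial.X 0 : Chart) isUnit_chartFlip

lemma flip_chart (f : Chart) : flip (chartToOverlap f) = chartFlip f :=
  IsLocalization.Away.lift_eq _ _ _

lemma flip_invCoord : flip invCoord = chartToOverlap (MvPolynomial.X 0) := by
  have h : flip (chartToOverlap (MvPolynomial.X 0)) * flip invCoord = 1 := by
    rw [← map_mul, coord_mul_invCoord, map_one]
  rw [flip_chart] at h
  have h2 : chartFlip (MvPolynomial.X 0) * chartToOverlap (MvPolynomial.X 0) = 1 := by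
    simpa [chartFlip, mul_comm] using coord_mul_invCoord
  exact isUnit_chartFlip.mul_left_cancel (h.trans h2.symm)

lemma flip_flip : flip.comp flip = RingHom.id Overlap := by
  refine IsLocalization.ringHom_ext (Submonoid.powers (MvPolynomial.X 0 : Chart)) ?_
  refine MvPolynomial.ringHom_ext (fun c => ?_) (fun i => ?_)
  · have h : ∀ c : ℂ, flip (algebraMap Chart Overlap (MvPolynomial.C c)) =
        algebraMap Chart Overlap (MvPolynomial.C c) := fun c => by
      refine (flip_chart _).trans ?_
      simp only [chartFlip, AlgHom.toRingHom_eq_coe, RingHom.coe_coe, MvPolynomial.algHom_C]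
      exact IsScalarTower.algebraMap_apply ℂ Chart Overlap c
    simp [h]
  · have h0 : flip (chartToOverlap (MvPolynomial.X 0)) = invCoord := by
      rw [flip_chart]; simp [chartFlip]
    have h1 : flip (chartToOverlap (MvPolynomial.X 1)) =
      -(chartToOverlap (MvPolynomial.X 0) ^ 2 * chartToOverlap (MvPolynomial.X 1)) := by
      rw [flip_chart]; simp [chartFlip]
    fin_cases i
    · show flip (flip (chartToOverlap (MvPolynomial.X 0))) = chartToOverlap (MvPolynomial.X 0)
      rw [h0, flip_invCoord]
    · show flip (flip (chartToOverlap (MvPolynomial.X 1))) = chartToOverlap (MvPolynomial.X 1)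
      rw [h1]
      simp only [map_neg, map_mul, map_pow, h0, h1]
      linear_combination (chartToOverlap (MvPolynomial.X 1)) * (invCoord *
        chartToOverlap (MvPolynomial.X 0) + 1) * coord_mul_invCoord

/-- The coordinate change as an isomorphism. -/
def flipIso : CommRingCat.of Overlap ≅ CommRingCat.of Overlap where
  hom := CommRingCat.ofHom flip
  inv := CommRingCat.ofHom flip
  hom_inv_id := by rw [← CommRingCat.ofHom_comp, flip_flip]; rfl
  inv_hom_id := by rw [← CommRingCat.ofHom_comp, flip_flip]; rfl

/-- The inclusion of the overlap in the first chart. -/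
def overlapLeft : Spec (CommRingCat.of Overlap) ⟶ Spec (CommRingCat.of Chart) :=
  Spec.map (CommRingCat.ofHom chartToOverlap)

instance : IsOpenImmersion overlapLeft :=
  inferInstanceAs (IsOpenImmersion (Spec.map (CommRingCat.ofHom (algebraMap Chart Overlap))))

/-- The inclusion of the overlap in the second chart. -/
def overlapRight : Spec (CommRingCat.of Overlap) ⟶ Spec (CommRingCat.of Chart) :=
  Spec.map flipIso.hom ≫ overlapLeft

instance : IsOpenImmersion overlapRight :=
  inferInstanceAs (IsOpenImmersion (Spec.map flipIso.hom ≫ overlapLeft))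

/-- The cotangent bundle `T*ℙ¹`: two affine planes glued along the overlap. -/
def TP1 : Scheme.{0} := pushout overlapLeft overlapRight



/-- The coordinate ring `ℂ[u]` of a standard chart of `ℙ¹`. -/
abbrev Line : Type := Polynomial ℂ
/-- The coordinate ring `ℂ[u, u⁻¹]` of the overlap of the two charts of `ℙ¹`. -/
abbrev LineOverlap : Type := Localization.Away (Polynomial.X : Line)
/-- The localization map `ℂ[u] → ℂ[u, u⁻¹]`. -/
def lineToOverlap : Line →+* LineOverlap := algebraMap Line LineOverlap
/-- The element `u⁻¹`. -/
def lineInv : LineOverlap := IsLocalization.Away.invSelf (Polynomial.X : Line)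

lemma coord_mul_lineInv : lineToOverlap Polynomial.X * lineInv = 1 :=
  IsLocalization.Away.mul_invSelf _

/-- The map `u ↦ u⁻¹` on a chart. -/
def lineChartFlip : Line →+* LineOverlap := (Polynomial.aeval (R := ℂ) lineInv).toRingHom

lemma isUnit_lineChartFlip : IsUnit (lineChartFlip Polynomial.X) := by
  refine IsUnit.of_mul_eq_one (lineToOverlap Polynomial.X) ?_
  simpa [lineChartFlip, mul_comm] using coord_mul_lineInv

/-- The coordinate change `u ↦ u⁻¹` of `ℂ[u, u⁻¹]`. -/
def lineFlip : LineOverlap →+* LineOverlap :=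
  IsLocalization.Away.lift (Polynomial.X : Line) isUnit_lineChartFlip

lemma lineFlip_chart (f : Line) : lineFlip (lineToOverlap f) = lineChartFlip f :=
  IsLocalization.Away.lift_eq _ _ _

lemma lineFlip_inv : lineFlip lineInv = lineToOverlap Polynomial.X := by
  have h : lineFlip (lineToOverlap Polynomial.X) * lineFlip lineInv = 1 := by
    rw [← map_mul, coord_mul_lineInv, map_one]
  rw [lineFlip_chart] at h
  have h2 : lineChartFlip Polynomial.X * lineToOverlap Polynomial.X = 1 := by
    simpa [lineChartFlip, mul_comm] using coord_mul_lineInv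
  exact isUnit_lineChartFlip.mul_left_cancel (h.trans h2.symm)

lemma lineFlip_C (c : ℂ) : lineFlip (algebraMap Line LineOverlap (Polynomial.C c)) =
    algebraMap Line LineOverlap (Polynomial.C c) := by
  refine (lineFlip_chart _).trans ?_
  simp only [lineChartFlip, AlgHom.toRingHom_eq_coe, RingHom.coe_coe, Polynomial.aeval_C]
  exact IsScalarTower.algebraMap_apply ℂ Line LineOverlap c

lemma lineFlip_lineFlip : lineFlip.comp lineFlip = RingHom.id LineOverlap := by
  refine IsLocalization.ringHom_ext (Submonoid.powers (Polynomial.X : Line)) ?_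
  refine Polynomial.ringHom_ext (fun c => ?_) ?_
  · simp [lineFlip_C]
  · show lineFlip (lineFlip (lineToOverlap Polynomial.X)) = lineToOverlap Polynomial.X
    have h0 : lineFlip (lineToOverlap Polynomial.X) = lineInv := by
      rw [lineFlip_chart]; simp [lineChartFlip]
    rw [h0, lineFlip_inv]

/-- The coordinate change as an isomorphism. -/
def lineFlipIso : CommRingCat.of LineOverlap ≅ CommRingCat.of LineOverlap where
  hom := CommRingCat.ofHom lineFlip
  inv := CommRingCat.ofHom lineFlip
  hom_inv_id := by rw [← CommRingCat.ofHom_comp, lineFlip_lineFlip]; rfl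
  inv_hom_id := by rw [← CommRingCat.ofHom_comp, lineFlip_lineFlip]; rfl

/-- The inclusion of the overlap in the first chart. -/
def lineLeft : Spec (CommRingCat.of LineOverlap) ⟶ Spec (CommRingCat.of Line) :=
  Spec.map (CommRingCat.ofHom lineToOverlap)

instance : IsOpenImmersion lineLeft :=
  inferInstanceAs (IsOpenImmersion (Spec.map (CommRingCat.ofHom (algebraMap Line LineOverlap))))

/-- The inclusion of the overlap in the second chart. -/
def lineRight : Spec (CommRingCat.of LineOverlap) ⟶ Spec (CommRingCat.of Line) :=
  Spec.map lineFlipIso.hom ≫ lineLeft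

instance : IsOpenImmersion lineRight :=
  inferInstanceAs (IsOpenImmersion (Spec.map lineFlipIso.hom ≫ lineLeft))

/-- The projective line `ℙ¹`: two affine lines glued along the overlap. -/
def P1 : Scheme.{0} := pushout lineLeft lineRight

/-- The zero section `u ↦ u`, `p ↦ 0` on a chart. -/
def zeroChart : Chart →+* Line := (MvPolynomial.aeval (R := ℂ) ![Polynomial.X, 0]).toRingHom

lemma isUnit_zeroOverlap : IsUnit (lineToOverlap.comp zeroChart (MvPolynomial.X 0)) := by
  refine IsUnit.of_mul_eq_one lineInv ?_
  simpa [zeroChart] using coord_mul_lineInv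

/-- The zero section on the overlap. -/
def zeroOverlap : Overlap →+* LineOverlap :=
  IsLocalization.Away.lift (MvPolynomial.X 0 : Chart) isUnit_zeroOverlap

lemma zeroOverlap_chart (f : Chart) :
    zeroOverlap (chartToOverlap f) = lineToOverlap (zeroChart f) :=
  IsLocalization.Away.lift_eq _ _ _

lemma zeroOverlap_inv : zeroOverlap invCoord = lineInv := by
  have h : zeroOverlap (chartToOverlap (MvPolynomial.X 0)) * zeroOverlap invCoord = 1 := by
    rw [← map_mul, coord_mul_invCoord, map_one]
  rw [zeroOverlap_chart] at h
  have h2 : lineToOverlap (zeroChart (MvPolynomial.X 0)) * lineInv = 1 := by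
    simpa [zeroChart] using coord_mul_lineInv
  exact isUnit_zeroOverlap.mul_left_cancel (h.trans h2.symm)

lemma zeroOverlap_flip : zeroOverlap.comp flip = lineFlip.comp zeroOverlap := by
  refine IsLocalization.ringHom_ext (Submonoid.powers (MvPolynomial.X 0 : Chart)) ?_
  refine MvPolynomial.ringHom_ext (fun c => ?_) (fun i => ?_)
  · show zeroOverlap (flip (chartToOverlap (MvPolynomial.C c))) =
      lineFlip (zeroOverlap (chartToOverlap (MvPolynomial.C c)))
    have h1 : chartFlip (MvPolynomial.C c) = chartToOverlap (MvPolynomial.C c) := by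
      simp only [chartFlip, AlgHom.toRingHom_eq_coe, RingHom.coe_coe, MvPolynomial.algHom_C]
      exact IsScalarTower.algebraMap_apply ℂ Chart Overlap c
    have h2 : zeroChart (MvPolynomial.C c) = Polynomial.C c := by
      simp [zeroChart]
    rw [flip_chart, h1, zeroOverlap_chart, h2]
    exact (lineFlip_C c).symm
  · fin_cases i
    · show zeroOverlap (flip (chartToOverlap (MvPolynomial.X 0))) =
        lineFlip (zeroOverlap (chartToOverlap (MvPolynomial.X 0)))
      rw [flip_chart, zeroOverlap_chart]
      simp [chartFlip, zeroChart, zeroOverlap_inv, lineFlip_chart, lineChartFlip]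
    · show zeroOverlap (flip (chartToOverlap (MvPolynomial.X 1))) =
        lineFlip (zeroOverlap (chartToOverlap (MvPolynomial.X 1)))
      rw [flip_chart, zeroOverlap_chart]
      simp [chartFlip, zeroChart, zeroOverlap_chart]

/-- The zero section `i : ℙ¹ → T*ℙ¹`. -/
def zeroSection : P1 ⟶ TP1 :=
  pushout.map lineLeft lineRight overlapLeft overlapRight
    (Spec.map (CommRingCat.ofHom zeroChart)) (Spec.map (CommRingCat.ofHom zeroChart))
    (Spec.map (CommRingCat.ofHom zeroOverlap))
    (by
      simp only [lineLeft, overlapLeft, ← Spec.map_comp, ← CommRingCat.ofHom_comp]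
      congr 2
      exact RingHom.ext fun f => (zeroOverlap_chart f).symm)
    (by
      simp only [lineRight, overlapRight, lineLeft, overlapLeft, lineFlipIso, flipIso,
        ← Spec.map_comp, ← CommRingCat.ofHom_comp]
      congr 2
      rw [← RingHom.comp_assoc, zeroOverlap_flip, RingHom.comp_assoc, RingHom.comp_assoc]
      congr 1
      exact RingHom.ext fun f => (zeroOverlap_chart f).symm)

open Classical in
/-- The closed point `[y₀ : y₁]` of `ℙ¹` for `y = (y₀, y₁) ≠ 0`, with `u = y₁ / y₀` on the first chart
and `u⁻¹ = y₀ / y₁` on the second. -/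
def point (y : ℂ × ℂ) : Spec (CommRingCat.of ℂ) ⟶ P1 :=
  if y.1 ≠ 0 then
    Spec.map (CommRingCat.ofHom (Polynomial.evalRingHom (y.2 / y.1))) ≫
      pushout.inl lineLeft lineRight
  else
    Spec.map (CommRingCat.ofHom (Polynomial.evalRingHom (y.1 / y.2))) ≫
      pushout.inr lineLeft lineRight

/-- The structure sheaf as a sheaf of modules. -/
def structureSheaf (X : Scheme.{0}) : X.Modules := SheafOfModules.unit X.ringCatSheaf

/-- The restriction of functions `𝒪_X → f_* 𝒪_Y`. -/
def restrictToImage {Y X : Scheme.{0}} (f : Y ⟶ X) :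
    structureSheaf X ⟶ (Scheme.Modules.pushforward f).obj (structureSheaf Y) :=
  SheafOfModules.unitToPushforwardObjUnit f.toRingCatSheafHom

/-- `𝒪(-1)` on `ℙ¹`: the ideal sheaf of the point `[1 : 0]`. -/
def lineBundleNegOne : P1.Modules := kernel (restrictToImage (point (1, 0)))

/-- `𝒪(-2)` on `ℙ¹`: the ideal sheaf of the two points `[1 : 0]` and `[0 : 1]`. -/
def lineBundleNegTwo : P1.Modules :=
  kernel (prod.lift (restrictToImage (point (1, 0))) (restrictToImage (point (0, 1))))

/-- `i_* 𝒪_{ℙ¹}(-1)`. -/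
def pushNegOne : TP1.Modules := (Scheme.Modules.pushforward zeroSection).obj lineBundleNegOne
/-- `i_* 𝒪_{ℙ¹}(-2)`. -/
def pushNegTwo : TP1.Modules := (Scheme.Modules.pushforward zeroSection).obj lineBundleNegTwo
/-- `i_* 𝒪_y` for `y = [y₀ : y₁]`. -/
def skyscraper (y : ℂ × ℂ) : TP1.Modules :=
  (Scheme.Modules.pushforward (point y ≫ zeroSection)).obj (structureSheaf _)

/-- Coherent sheaves on `T*ℙ¹` (which is noetherian, so coherent means locally finitely presented)
supported over the zero section: they have no sections on the open sets that do not meet it. -/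
def IsCoherentOverP1 : ObjectProperty TP1.Modules := fun M =>
  SheafOfModules.IsFinitePresentation (R := TP1.ringCatSheaf) M ∧
    ∀ U : TP1.Opens, Disjoint (U : Set TP1) (Set.range zeroSection) → Subsingleton Γ(M, U)

variable [HasDerivedCategory.{w} TP1.Modules]
/-- The objects of `D(T*ℙ¹)` obtained from the coherent sheaves supported over `ℙ¹`, placed in degree `0`,
by shifts, finite sums, extensions and direct summands.  These are the complexes whose cohomology
sheaves are coherent, supported over `ℙ¹`, and zero in all but finitely many degrees. -/
def coherentComplexes : ObjectProperty (DerivedCategory TP1.Modules) :=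
  (IsCoherentOverP1.map (DerivedCategory.singleFunctor TP1.Modules 0) ⊔ IsZero).triangEnvelope

instance : coherentComplexes.IsTriangulated := by
  have : (IsCoherentOverP1.map (DerivedCategory.singleFunctor TP1.Modules 0) ⊔
      IsZero).Nonempty := ⟨0, Or.inr (isZero_zero _)⟩
  unfold coherentComplexes
  infer_instance
/-- The triangulated category `D^b_{ℙ¹}(Coh T*ℙ¹)`. -/
abbrev DbP1 := coherentComplexes.FullSubcategory

end A1Geometry

section Main

variable {C : Type u} [Category.{v} C] [Preadditive C] [HasZeroObject C] [HasShift C ℤ]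
  [∀ n : ℤ, (shiftFunctor C n).Additive] [Pretriangulated C]

/-- The central charge of the `A₁` periods, when `point y` are the objects `i_* 𝒪_y` and `line` is the object
`i_* 𝒪_{ℙ¹}(-1)` (each up to isomorphism): `Z(i_* 𝒪_y) = ϖ₀` and `Z(i_* 𝒪_{ℙ¹}(-1)) = ϖ₁`. -/
def IsA1Charge (point : ℂ × ℂ → ObjectProperty C) (line : ObjectProperty C) (p : A1Branch)
    (Z : TriangulatedK0 C →+ ℂ) : Prop :=
  (∀ y : ℂ × ℂ, y ≠ 0 → ∀ X, point y X → Z (k0Class X) = p.period₀) ∧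
    ∀ X, line X → Z (k0Class X) = p.period₁

/-- The `A₁` periods give Bridgeland stability conditions on the heart of `t`, which vary continuously with
the periods, and each variation of the periods gives a wall-crossing of the second kind which is not
one of dilation and rotation. -/
structure A1WallCrossings (t : TStructure C) (point : ℂ × ℂ → ObjectProperty C)
    (line : ObjectProperty C) : Prop where
  exists_family : ∃ σ : A1Branch → StabilityCondition t,
    (∀ p, (σ p).IsBridgeland ∧ IsA1Charge point line p (σ p).Z ∧
      ∀ Q, (σ p).semistable Q → (σ p).phase Q = Complex.arg ((σ p).Z (k0Class Q))) ∧
    ∀ (p : A1Branch) (ε : ℝ), 0 < ε → ∃ δ : ℝ, 0 < δ ∧ ∀ p' : A1Branch,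
      ‖p'.period₁ - p.period₁‖ < δ → ∀ Q, (σ p).semistable Q →
        |(σ p').phase Q - (σ p).phase Q| < ε ∧
        |Real.log (‖(σ p').Z (k0Class Q)‖ / ‖(σ p).Z (k0Class Q)‖)| < ε
  wallCrossing : ∀ p p' : A1Branch, p.period₁ ≠ p'.period₁ →
    ∀ σ σ' : StabilityCondition t, σ.IsBridgeland → σ'.IsBridgeland →
      IsA1Charge point line p σ.Z → IsA1Charge point line p' σ'.Z →
        σ.WallCrossingSecondKind σ' ∧ ¬ σ.ByDilationRotation σ' ∧ ¬ σ.SameTiltsUpToRotation σ'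

end Main

namespace A1Geometry

variable [HasDerivedCategory.{w} TP1.Modules]

/-- The objects of `D^b_{ℙ¹}(Coh T*ℙ¹)` isomorphic to `i_* 𝒪_y`. -/
def isSkyscraper (y : ℂ × ℂ) : ObjectProperty DbP1.{w} := fun X =>
  Nonempty (X.obj ≅ (DerivedCategory.singleFunctor TP1.Modules 0).obj (skyscraper y))

/-- The objects of `D^b_{ℙ¹}(Coh T*ℙ¹)` isomorphic to `i_* 𝒪_{ℙ¹}(-1)`. -/
def isPushNegOne : ObjectProperty DbP1.{w} := fun X =>
  Nonempty (X.obj ≅ (DerivedCategory.singleFunctor TP1.Modules 0).obj pushNegOne)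

/-- The objects of `D^b_{ℙ¹}(Coh T*ℙ¹)` isomorphic to `i_* 𝒪_{ℙ¹}(-2)[1]`. -/
def isPushNegTwoShift : ObjectProperty DbP1.{w} := fun X =>
  Nonempty (X.obj ≅
    ((DerivedCategory.singleFunctor TP1.Modules 0).obj pushNegTwo)⟦(1 : ℤ)⟧)

/-- The given identification of the heart of `t` with `mod^nil K` is the standard one: the simple representations
are `i_* 𝒪_{ℙ¹}(-1)` and `i_* 𝒪_{ℙ¹}(-2)[1]`, and the representation `R_y` is `i_* 𝒪_y`. -/
def IsStandardHeart (t : TStructure DbP1.{w}) [t.Heart DoubledKronecker.NilRep] : Prop :=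
  isPushNegOne (t.ιHeart.obj (DoubledKronecker.simple DoubledKronecker.Vertex.t)) ∧
    isPushNegTwoShift (t.ιHeart.obj (DoubledKronecker.simple DoubledKronecker.Vertex.s)) ∧
    ∀ y : ℂ × ℂ, y ≠ 0 → isSkyscraper y (t.ιHeart.obj (DoubledKronecker.pointObj y))

end A1Geometry

end

/-! Write w for the period ϖ₁. The inequality |β₀| < |β₁| says that Im w > 0
(`A1Branch.period₁_im_pos`). A nilpotent representation is an iterated extension of S_s and S_t, and
R_y has the class of their sum, so the prescribed values force the charge a(1 - w) + bw on the
dimension vector (a, b) (`isA1Charge_iff`). Conversely this additive function on the heart extends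
to the Grothendieck group of the triangulated category as an Euler characteristic
(`IsHeartAdditive.exists_hom`).

The numbers 1 - w and w lie in opposite open half-planes and have sum 1. The cone that they span
therefore has an angle less than π and avoids the negative real axis, and the arguments in it are
ordered as the slopes b/(a + b) (`arg_dimCharge_lt_iff`). This order does not depend on w. Maximal
destabilizing quotients give Harder-Narasimhan filtrations for the slope, hence existence. The
family is uniformly continuous in the objects because |Im Z| = |b - a| Im w bounds the relative
change of Z by |w' - w| / Im w (`dimCharge_continuous`).

Any Bridgeland stability condition with such a charge has the slope semistable representations as
its semistable objects (`HasPeriod.semistable_iff`), and its phases are arg Z + 2πk with one k for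
all objects (`HasPeriod.exists_phase_eq_uniform`). So the semistable objects and the order of their
phases never change.

The phases themselves do change. A semistable Q lies in the tilted heart at φ exactly when φ is less
than its phase (`StabilityCondition.tilt_iff`), so the tilted hearts determine the phases. The
phases of S_s, S_t and one semistable object of charge 1 determine, even up to a common shift, the
angles at 0 and 1 of the triangle 0, 1, w, and hence w (`HasPeriod.eq_of_phase_eq_add`). Different
periods thus give different tilts, also up to rotation. A dilation and rotation of the charge would
have to fix the value 1, so it would be trivial. -/

section Devissage

/-! ### Additivity of Euler functions on distinguished triangles -/

variable {C : Type u} [Category.{v} C] [Preadditive C] [HasZeroObject C] [HasShift C ℤ]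
  [∀ n : ℤ, (shiftFunctor C n).Additive] [Pretriangulated C]

/-- There is a distinguished triangle with the given vertices. -/
def ExistsTriangle (X Y Z : C) : Prop :=
  ∃ (f : X ⟶ Y) (g : Y ⟶ Z) (h : Z ⟶ X⟦(1 : ℤ)⟧), Triangle.mk f g h ∈ distTriang C

namespace ExistsTriangle

lemma of_mem {T : Triangle C} (hT : T ∈ distTriang C) : ExistsTriangle T.obj₁ T.obj₂ T.obj₃ :=
  ⟨T.mor₁, T.mor₂, T.mor₃, hT⟩

variable {X Y Z : C}

lemma rotate (h : ExistsTriangle X Y Z) : ExistsTriangle Y Z (X⟦(1 : ℤ)⟧) := by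
  obtain ⟨f, g, k, hT⟩ := h
  exact of_mem (rot_of_distTriang _ hT)

lemma invRotate (h : ExistsTriangle X Y Z) : ExistsTriangle (Z⟦(-1 : ℤ)⟧) X Y := by
  obtain ⟨f, g, k, hT⟩ := h
  exact of_mem (inv_rot_of_distTriang _ hT)

lemma shift (h : ExistsTriangle X Y Z) (n : ℤ) : ExistsTriangle (X⟦n⟧) (Y⟦n⟧) (Z⟦n⟧) := by
  obtain ⟨f, g, k, hT⟩ := h
  exact of_mem (Triangle.shift_distinguished _ hT n)

lemma of_iso {X' Y' Z' : C} (h : ExistsTriangle X Y Z) (e₁ : X ≅ X') (e₂ : Y ≅ Y')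
    (e₃ : Z ≅ Z') : ExistsTriangle X' Y' Z' := by
  obtain ⟨f, g, k, hT⟩ := h
  refine ⟨e₁.inv ≫ f ≫ e₂.hom, e₂.inv ≫ g ≫ e₃.hom, e₃.inv ≫ k ≫ e₁.hom⟦(1 : ℤ)⟧', ?_⟩
  refine isomorphic_distinguished _ hT _ (Triangle.isoMk _ _ e₁.symm e₂.symm e₃.symm ?_ ?_ ?_)
  · change (e₁.inv ≫ f ≫ e₂.hom) ≫ e₂.inv = e₁.inv ≫ f
    simp
  · change (e₂.inv ≫ g ≫ e₃.hom) ≫ e₃.inv = e₂.inv ≫ g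
    simp
  · change (e₃.inv ≫ k ≫ e₁.hom⟦(1 : ℤ)⟧') ≫ e₁.inv⟦(1 : ℤ)⟧' = e₃.inv ≫ k
    rw [Category.assoc, Category.assoc, ← Functor.map_comp, e₁.hom_inv_id,
      CategoryTheory.Functor.map_id, Category.comp_id]

lemma truncation (t : TStructure C) (n : ℤ) (X : C) :
    ExistsTriangle ((t.truncLT n).obj X) X ((t.truncGE n).obj X) :=
  of_mem (t.triangleLTGE_distinguished n X)

lemma isLE₂ (h : ExistsTriangle X Y Z) (t : TStructure C) (n : ℤ) (h₁ : t.IsLE X n)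
    (h₃ : t.IsLE Z n) : t.IsLE Y n := by
  obtain ⟨f, g, k, hT⟩ := h
  exact t.isLE₂ _ hT n h₁ h₃

lemma isGE₂ (h : ExistsTriangle X Y Z) (t : TStructure C) (n : ℤ) (h₁ : t.IsGE X n)
    (h₃ : t.IsGE Z n) : t.IsGE Y n := by
  obtain ⟨f, g, k, hT⟩ := h
  exact t.isGE₂ _ hT n h₁ h₃

lemma isLE₃ (h : ExistsTriangle X Y Z) (t : TStructure C) (n : ℤ) (h₁ : t.IsLE X (n + 1))
    (h₂ : t.IsLE Y n) : t.IsLE Z n :=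
  h.rotate.isLE₂ t n h₂ (t.isLE_shift X (n + 1) 1 n)

lemma isGE₁ (h : ExistsTriangle X Y Z) (t : TStructure C) (n : ℤ) (h₂ : t.IsGE Y n)
    (h₃ : t.IsGE Z (n - 1)) : t.IsGE X n :=
  h.invRotate.isGE₂ t n (t.isGE_shift Z (n - 1) (-1) n) h₂

variable [IsTriangulated C]

/-- The cone of a composition is an extension of the cones. -/
lemma comp_cone {A B : C} (h : ExistsTriangle X Y A) (h' : ExistsTriangle Y Z B) :
    ∃ W, ExistsTriangle X Z W ∧ ExistsTriangle A W B := by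
  obtain ⟨f, v, k, hT⟩ := h
  obtain ⟨g, v', k', hT'⟩ := h'
  obtain ⟨W, v'', k'', hW⟩ := distinguished_cocone_triangle (f ≫ g)
  exact ⟨W, ⟨_, _, _, hW⟩, ⟨_, _, _, (Triangulated.someOctahedron rfl hT hT' hW).mem⟩⟩

/-- The fibre of a composition is an extension of the fibres. -/
lemma comp_fiber {W A : C} (h : ExistsTriangle X Y Z) (h' : ExistsTriangle A Z W) :
    ∃ P, ExistsTriangle P Y W ∧ ExistsTriangle X P A := by
  obtain ⟨U, h₁, h₂⟩ := comp_cone h.rotate h'.rotate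
  refine ⟨U⟦(-1 : ℤ)⟧, h₁.invRotate, (h₂.shift (-1)).of_iso ?_ (Iso.refl _) ?_⟩
  · exact (shiftEquiv C (1 : ℤ)).unitIso.symm.app X
  · exact (shiftEquiv C (1 : ℤ)).unitIso.symm.app A

end ExistsTriangle

open ExistsTriangle

variable {G : Type*} [AddCommGroup G]

/-- A function on objects which is additive on truncation triangles and on short exact sequences in
the heart, and changes its sign under the shift. -/
structure IsEulerFunction (t : TStructure C) (χ : C → G) : Prop where
  trunc {X Y Z : C} (h : ExistsTriangle X Y Z) (n : ℤ) (hX : t.IsLE X (n - 1)) (hZ : t.IsGE Z n) :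
    χ Y = χ X + χ Z
  heart {X Y Z : C} (h : ExistsTriangle X Y Z) (hX : t.heart X) (hY : t.heart Y)
    (hZ : t.heart Z) : χ Y = χ X + χ Z
  iso {X Y : C} (e : X ≅ Y) : χ X = χ Y
  shift (X : C) : χ (X⟦(1 : ℤ)⟧) = - χ X

namespace IsEulerFunction

variable {t : TStructure C} {χ : C → G} (hχ : IsEulerFunction t χ)
include hχ

lemma shift_neg_one (X : C) : χ (X⟦(-1 : ℤ)⟧) = - χ X := by
  have e : χ (X⟦(-1 : ℤ)⟧⟦(1 : ℤ)⟧) = χ X := hχ.iso ((shiftEquiv C (1 : ℤ)).counitIso.app X)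
  rw [← e, hχ.shift, neg_neg]

lemma shift_iff_aux (X Y Z : C) :
    χ (Y⟦(-1 : ℤ)⟧) = χ (X⟦(-1 : ℤ)⟧) + χ (Z⟦(-1 : ℤ)⟧) ↔ χ Y = χ X + χ Z := by
  simp only [hχ.shift_neg_one]
  rw [← neg_add, neg_inj]

lemma pure_neg_one {X Y Z : C} (h : ExistsTriangle X Y Z)
    (hX : t.IsLE X (-1) ∧ t.IsGE X (-1)) (hY : t.IsLE Y (-1) ∧ t.IsGE Y (-1))
    (hZ : t.IsLE Z (-1) ∧ t.IsGE Z (-1)) : χ Y = χ X + χ Z := by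
  have key : ∀ X : C, t.IsLE X (-1) ∧ t.IsGE X (-1) → t.heart (X⟦(-1 : ℤ)⟧) := by
    rintro X ⟨_, _⟩
    exact (t.mem_heart_iff _).2 ⟨t.isLE_shift X (-1) (-1) 0, t.isGE_shift X (-1) (-1) 0⟩
  exact (hχ.shift_iff_aux X Y Z).1 (hχ.heart (h.shift (-1)) (key _ hX) (key _ hY) (key _ hZ))

lemma shift_natCast_iff (n : ℕ) (X Y Z : C) :
    (χ (Y⟦(n : ℤ)⟧) = χ (X⟦(n : ℤ)⟧) + χ (Z⟦(n : ℤ)⟧)) ↔ χ Y = χ X + χ Z := by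
  induction n with
  | zero => simp [hχ.iso ((shiftFunctorZero C ℤ).app _)]
  | succ n ih =>
    rw [← ih]
    have h (X : C) : χ (X⟦((n + 1 : ℕ) : ℤ)⟧) = - χ (X⟦(n : ℤ)⟧) := by
      rw [← hχ.shift]
      exact hχ.iso ((shiftFunctorAdd' C (n : ℤ) 1 _ (by simp)).app X)
    rw [h, h, h, ← neg_add, neg_inj]

lemma shift_int_iff (n : ℤ) (X Y Z : C) :
    (χ (Y⟦n⟧) = χ (X⟦n⟧) + χ (Z⟦n⟧)) ↔ χ Y = χ X + χ Z := by
  obtain ⟨m, rfl | rfl⟩ := n.eq_nat_or_neg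
  · exact hχ.shift_natCast_iff m X Y Z
  · rw [← hχ.shift_natCast_iff m (X⟦-(m : ℤ)⟧)]
    have h (X : C) : χ (X⟦-(m : ℤ)⟧⟦(m : ℤ)⟧) = χ X :=
      hχ.iso ((shiftFunctorCompIsoId C (-(m : ℤ)) m (by simp)).app X)
    rw [h, h, h]

variable [IsTriangulated C]

/-- `W` is the cone of a morphism S[-1] → T of the heart. Its truncations are the cokernel and the
shifted kernel, and the octahedral axiom supplies the image `I`. The two short exact sequences
through `I` give the claim. -/
lemma of_heart_of_neg_one {T W S : C} (h : ExistsTriangle T W S) (hT : t.heart T)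
    (hS : t.IsLE S (-1) ∧ t.IsGE S (-1)) : χ W = χ T + χ S := by
  obtain ⟨_, _⟩ := hS
  obtain ⟨_, _⟩ := (t.mem_heart_iff _).1 hT
  have hW : t.IsLE W 0 := h.isLE₂ t 0 inferInstance (t.isLE_of_le S (-1) 0)
  have hW' : t.IsGE W (-1) := h.isGE₂ t (-1) (t.isGE_of_ge T (-1) 0) inferInstance
  have hA := truncation t 0 W
  have hA₁ : t.IsLE ((t.truncLT 0).obj W) (-1) := t.isLE_truncLT_obj W 0 (-1)
  obtain ⟨I, hI, hI'⟩ := comp_fiber h.invRotate hA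
  have : t.IsLE (S⟦(-1 : ℤ)⟧) 0 := t.isLE_shift S (-1) (-1) 0
  have : t.IsGE (S⟦(-1 : ℤ)⟧) 0 := t.isGE_shift S (-1) (-1) 0
  have hI₁ : t.IsLE I 0 := hI'.isLE₂ t 0 inferInstance (t.isLE_of_le _ (-1) 0)
  have hI₂ : t.IsGE I 0 := hI.isGE₁ t 0 inferInstance (t.isGE_of_ge _ (0 - 1) 0)
  have e₁ := hχ.trunc hA 0 hA₁ inferInstance
  have e₂ := hχ.heart hI ((t.mem_heart_iff _).2 ⟨hI₁, hI₂⟩) hT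
    ((t.mem_heart_iff _).2 ⟨inferInstance, inferInstance⟩)
  have e₃ := hχ.heart hI'.invRotate ((t.mem_heart_iff _).2
      ⟨t.isLE_shift _ (-1) (-1) 0, t.isGE_shift _ (-1) (-1) 0⟩)
    ((t.mem_heart_iff _).2 ⟨inferInstance, inferInstance⟩) ((t.mem_heart_iff _).2 ⟨hI₁, hI₂⟩)
  rw [hχ.shift_neg_one, hχ.shift_neg_one] at e₃
  rw [e₁, e₂, ← neg_neg (χ S), e₃]
  abel

/-- Splitting off the part of `V` below degree -1 leaves a short exact sequence concentrated in
degree -1. -/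
lemma of_le_neg_one {V Z A : C} (h : ExistsTriangle V Z A) (hV : t.IsLE V (-1))
    (hA : t.IsLE A (-1) ∧ t.IsGE A (-1)) : χ Z = χ V + χ A := by
  obtain ⟨_, _⟩ := hA
  have hT := truncation t (-1) V
  obtain ⟨U, hU, hU'⟩ := comp_cone hT h
  have hU₁ : t.IsLE U (-1) := hU'.isLE₂ t (-1) inferInstance inferInstance
  have hU₂ : t.IsGE U (-1) := hU'.isGE₂ t (-1) inferInstance inferInstance
  rw [hχ.trunc hU (-1) inferInstance inferInstance, hχ.trunc hT (-1) inferInstance inferInstance,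
    hχ.pure_neg_one hU' ⟨inferInstance, inferInstance⟩ ⟨hU₁, hU₂⟩ ⟨inferInstance, inferInstance⟩]
  abel

/-- The start of the long exact cohomology sequence in disguise. `W` is the cone of S → H⁰(Y), which
the previous two lemmas handle, and `Z'` plays the role of the truncation of `Z` below degree 0: it
is an extension of the kernel part of `W` by the truncation of `Y`. -/
lemma of_heart_of_le {S Y Z : C} (h : ExistsTriangle S Y Z) (hS : t.heart S)
    (hY : t.IsLE Y 0) : χ Y = χ S + χ Z := by
  obtain ⟨_, _⟩ := (t.mem_heart_iff _).1 hS
  have hS₁ : t.IsLE (S⟦(1 : ℤ)⟧) (-1) := t.isLE_shift S 0 1 (-1)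
  have hS₂ : t.IsGE (S⟦(1 : ℤ)⟧) (-1) := t.isGE_shift S 0 1 (-1)
  have hV := truncation t 0 Y
  have hV₁ : t.IsLE ((t.truncLT 0).obj Y) (-1) := t.isLE_truncLT_obj Y 0 (-1)
  obtain ⟨W, hW, hW'⟩ := comp_cone hV h.rotate
  have hW₁ : t.IsGE W (-1) := hW'.isGE₂ t (-1) (t.isGE_of_ge _ (-1) 0) inferInstance
  have hW₂ : t.IsLE W 0 := hW'.isLE₂ t 0 inferInstance (t.isLE_of_le _ (-1) 0)
  have hA := truncation t 0 W
  have hA₁ : t.IsLE ((t.truncLT 0).obj W) (-1) := t.isLE_truncLT_obj W 0 (-1)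
  obtain ⟨Z', hZ, hZ'⟩ := comp_fiber hW hA
  have hZ₁ : t.IsLE Z' (-1) := hZ'.isLE₂ t (-1) inferInstance inferInstance
  have e₁ := hχ.trunc hV 0 hV₁ inferInstance
  have e₂ := hχ.of_heart_of_neg_one hW' ((t.mem_heart_iff _).2 ⟨inferInstance, inferInstance⟩)
    ⟨hS₁, hS₂⟩
  have e₃ := hχ.trunc hA 0 hA₁ inferInstance
  have e₄ := hχ.trunc hZ 0 hZ₁ inferInstance
  have e₅ := hχ.of_le_neg_one hZ' inferInstance ⟨inferInstance, inferInstance⟩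
  rw [hχ.shift] at e₂
  rw [e₄, e₅, e₁, add_assoc, ← e₃, e₂]
  abel

/-- A map from the heart factors through the truncation of `Y` to degrees at most 0. The octahedral
axiom shows that the part of `Y` in degrees at least 1 passes unchanged to `Z`. -/
lemma of_heart_left {S Y Z : C} (h : ExistsTriangle S Y Z) (hS : t.heart S) :
    χ Y = χ S + χ Z := by
  obtain ⟨_, _⟩ := (t.mem_heart_iff _).1 hS
  obtain ⟨f, g, k, hT⟩ := h
  obtain ⟨Z₀, v, k', hZ₀⟩ := distinguished_cocone_triangle (t.liftTruncLT f 0 1 rfl)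
  have H := Triangulated.someOctahedron (t.liftTruncLT_ι f 0 1 rfl) hZ₀
    (t.triangleLTGE_distinguished 1 Y) hT
  have h₁ : t.IsLE ((t.truncLT 1).obj Y) 0 := t.isLE_truncLT_obj Y 1 0
  have h₂ := hχ.of_heart_of_le ⟨_, _, _, hZ₀⟩ hS h₁
  have h₃ := hχ.trunc (truncation t 1 Y) 1 h₁ inferInstance
  have hZ₁ : t.IsLE Z₀ 0 := isLE₃ ⟨_, _, _, hZ₀⟩ t 0 (t.isLE_of_le S 0 1) h₁
  have h₄ := hχ.trunc (of_mem H.mem) 1 hZ₁ (inferInstanceAs (t.IsGE ((t.truncGE 1).obj Y) 1))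
  rw [h₃, h₂, add_assoc]
  exact congrArg _ h₄.symm

/-- An Euler function is additive on triangles with bounded first vertex. -/
lemma additive {X Y Z : C} (h : ExistsTriangle X Y Z) (hX : t.bounded X) :
    χ Y = χ X + χ Z := by
  obtain ⟨⟨a, ha⟩, ⟨b, hb⟩⟩ := hX
  obtain ⟨n, hn⟩ : ∃ n : ℕ, b ≤ a + n := ⟨(b - a).toNat, by omega⟩
  have hb' := t.isLE_of_le X b (a + n) hn
  clear hb hn
  -- Induction on the amplitude of `X`: its lowest cohomology object is split off and moved to the
  -- heart by a shift.
  induction n generalizing a X Y Z with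
  | zero =>
    have : t.IsLE X a := by simpa using hb'
    exact (hχ.shift_int_iff a X Y Z).1 (hχ.of_heart_left (h.shift a) ((t.mem_heart_iff _).2
      ⟨t.isLE_shift X a a 0, t.isGE_shift X a a 0⟩))
  | succ n ih =>
    have hT := truncation t (a + 1) X
    obtain ⟨W, hW, hW'⟩ := comp_cone hT h
    have h₁ : t.IsLE ((t.truncLT (a + 1)).obj X) a := t.isLE_truncLT_obj X (a + 1) a
    have e₁ := (hχ.shift_int_iff a _ _ _).1 (hχ.of_heart_left (hW.shift a)
      ((t.mem_heart_iff _).2 ⟨t.isLE_shift _ a a 0, t.isGE_shift _ a a 0⟩))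
    have e₂ := ih hW' (a + 1) inferInstance (by
      have : a + 1 + (n : ℤ) = a + ((n + 1 : ℕ) : ℤ) := by push_cast; ring
      rw [this]; infer_instance)
    have e₃ := hχ.trunc hT (a + 1) (by simpa using h₁) inferInstance
    rw [e₁, e₂, e₃, add_assoc]

end IsEulerFunction

/-! ### The alternating sum over the cohomology objects -/

section EulerCharacteristic

variable (t : TStructure C) (d : C → G)

/-- The contribution of the cohomology in degree `i` to the Euler characteristic. -/
noncomputable def eulerTerm (i : ℤ) (X : C) : G :=
  (i.negOnePow : ℤ) • d (((t.truncGELT i (i + 1)).obj X)⟦i⟧)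

/-- The alternating sum of the values of `d` on the cohomology objects. -/
noncomputable def eulerCharacteristic (X : C) : G := ∑ᶠ i : ℤ, eulerTerm t d i X

/-- A function which is additive on short exact sequences in the heart. -/
structure IsHeartAdditive : Prop where
  iso {X Y : C} (e : X ≅ Y) : d X = d Y
  add {X Y Z : C} (h : ExistsTriangle X Y Z) (hX : t.heart X) (hY : t.heart Y)
    (hZ : t.heart Z) : d Y = d X + d Z

variable {t d} (hd : IsHeartAdditive t d)
include hd

lemma IsHeartAdditive.of_isZero {X : C} (hX : IsZero X) : d X = 0 := by
  have h := hd.add (ExistsTriangle.of_mem (contractible_distinguished (0 : C)))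
    (((t.mem_heart_iff _).2 ⟨inferInstance, inferInstance⟩ : t.heart (0 : C)))
    (((t.mem_heart_iff _).2 ⟨inferInstance, inferInstance⟩ : t.heart (0 : C)))
    (((t.mem_heart_iff _).2 ⟨inferInstance, inferInstance⟩ : t.heart (0 : C)))
  have h' : d (0 : C) = d 0 + d 0 := h
  rw [hd.iso (hX.iso (isZero_zero C))]
  simpa using h'

lemma eulerTerm_iso (i : ℤ) {X Y : C} (e : (t.truncGELT i (i + 1)).obj X ≅
    (t.truncGELT i (i + 1)).obj Y) : eulerTerm t d i X = eulerTerm t d i Y := by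
  rw [eulerTerm, eulerTerm, hd.iso ((shiftFunctor C i).mapIso e)]

lemma eulerTerm_eq_zero (i : ℤ) {X : C} (hX : IsZero ((t.truncGELT i (i + 1)).obj X)) :
    eulerTerm t d i X = 0 := by
  rw [eulerTerm, hd.of_isZero ((shiftFunctor C i).map_isZero hX), smul_zero]

lemma eulerTerm_of_isGE (i : ℤ) (X : C) (h : t.IsGE X (i + 1)) : eulerTerm t d i X = 0 :=
  eulerTerm_eq_zero hd i ((t.truncGE i).map_isZero (t.isZero_truncLT_obj_of_isGE (i + 1) X))

lemma eulerTerm_of_isLE (i : ℤ) (X : C) (h : t.IsLE X (i - 1)) : eulerTerm t d i X = 0 :=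
  eulerTerm_eq_zero hd i (t.isZero_truncGE_obj_of_isLE (i - 1) i (by lia)
    ((t.truncLT (i + 1)).obj X))

lemma finite_support_eulerTerm {X : C} (hX : t.bounded X) :
    (Function.support fun i => eulerTerm t d i X).Finite := by
  obtain ⟨⟨a, ha⟩, ⟨b, hb⟩⟩ := hX
  refine (Set.finite_Icc a b).subset fun i hi => ?_
  by_contra h
  rw [Set.mem_Icc, not_and_or, not_le, not_le] at h
  refine hi ?_
  rcases h with h | h
  · exact eulerTerm_of_isGE hd i X (t.isGE_of_ge X (i + 1) a)
  · exact eulerTerm_of_isLE hd i X (t.isLE_of_le X b (i - 1))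

lemma eulerTerm_of_pure (n : ℤ) (X : C) (h : t.IsLE X n) (h' : t.IsGE X n) :
    eulerTerm t d n X = (n.negOnePow : ℤ) • d (X⟦n⟧) := by
  have h₁ := (t.isLE_iff_isIso_truncLTι_app n (n + 1) rfl X).1 h
  have e₁ := asIso ((t.truncLTι (n + 1)).app X)
  have e₂ : X ≅ (t.truncGE n).obj X := asIso ((t.truncGEπ n).app X)
  exact congrArg _ (hd.iso ((shiftFunctor C n).mapIso ((t.truncGE n).mapIso e₁ ≪≫ e₂.symm)))

lemma eulerCharacteristic_of_pure (n : ℤ) (X : C) (h : t.IsLE X n) (h' : t.IsGE X n) :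
    eulerCharacteristic t d X = (n.negOnePow : ℤ) • d (X⟦n⟧) := by
  rw [← eulerTerm_of_pure hd n X h h', eulerCharacteristic]
  refine finsum_eq_single _ n fun i hi => ?_
  rcases hi.lt_or_gt with hi | hi
  · exact eulerTerm_of_isGE hd i X (t.isGE_of_ge X (i + 1) n)
  · exact eulerTerm_of_isLE hd i X (t.isLE_of_le X n (i - 1))

lemma eulerCharacteristic_shift_of_pure (n : ℤ) (X : C) (h : t.IsLE X n) (h' : t.IsGE X n) :
    eulerCharacteristic t d (X⟦(1 : ℤ)⟧) = - eulerCharacteristic t d X := by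
  have e : d (X⟦n⟧) = d (X⟦(1 : ℤ)⟧⟦n - 1⟧) :=
    hd.iso ((shiftFunctorAdd' C 1 (n - 1) n (by lia)).app X)
  rw [eulerCharacteristic_of_pure hd n X h h', eulerCharacteristic_of_pure hd (n - 1) _
    (t.isLE_shift X n 1 (n - 1)) (t.isGE_shift X n 1 (n - 1)), Int.negOnePow_sub, e]
  simp

lemma eulerCharacteristic_of_heart {X : C} (h : t.heart X) : eulerCharacteristic t d X = d X := by
  obtain ⟨h₁, h₂⟩ := (t.mem_heart_iff _).1 h
  rw [eulerCharacteristic_of_pure hd 0 X h₁ h₂, hd.iso ((shiftFunctorZero C ℤ).app X)]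
  simp

variable [IsTriangulated C]

/-- In each degree only one of `X` and `Z` has cohomology, and there it agrees with that of `Y`.
Boundedness makes the sums finite, as `finsum` requires. -/
lemma eulerCharacteristic_trunc {X Y Z : C} (h : ExistsTriangle X Y Z) (n : ℤ)
    (hX : t.IsLE X (n - 1)) (hZ : t.IsGE Z n) (bX : t.bounded X) (bZ : t.bounded Z) :
    eulerCharacteristic t d Y = eulerCharacteristic t d X + eulerCharacteristic t d Z := by
  obtain ⟨f, g, k, hT⟩ := h
  rw [eulerCharacteristic, eulerCharacteristic, eulerCharacteristic, ← finsum_add_distrib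
    (finite_support_eulerTerm hd bX) (finite_support_eulerTerm hd bZ)]
  congr 1
  funext i
  rcases lt_or_ge i n with hi | hi
  · have hZ' : t.IsGE Z (i + 1) := t.isGE_of_ge Z (i + 1) n
    have : IsIso ((t.truncLT (i + 1)).map f) :=
      t.isIso₁_truncLT_map_of_isGE _ hT (i + 1) hZ'
    rw [eulerTerm_of_isGE hd i Z hZ', add_zero]
    exact (eulerTerm_iso hd i ((t.truncGE i).mapIso (asIso ((t.truncLT (i + 1)).map f)))).symm
  · have hX' : t.IsLE X (i - 1) := t.isLE_of_le X (n - 1) (i - 1)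
    have : IsIso ((t.truncGE i).map g) :=
      t.isIso₂_truncGE_map_of_isLE _ hT (i - 1) i (by lia) hX'
    rw [eulerTerm_of_isLE hd i X hX', zero_add]
    exact eulerTerm_iso hd i ((t.truncGELTIsoLTGE i (i + 1)).app Y ≪≫
      (t.truncLT (i + 1)).mapIso (asIso ((t.truncGE i).map g)) ≪≫
      ((t.truncGELTIsoLTGE i (i + 1)).app Z).symm)

lemma eulerCharacteristic_shift {X : C} (hX : t.bounded X) :
    eulerCharacteristic t d (X⟦(1 : ℤ)⟧) = - eulerCharacteristic t d X := by
  obtain ⟨⟨a, ha⟩, ⟨b, hb⟩⟩ := hX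
  obtain ⟨n, hn⟩ : ∃ n : ℕ, b ≤ a + n := ⟨(b - a).toNat, by omega⟩
  have hb' := t.isLE_of_le X b (a + n) hn
  clear hb hn
  induction n generalizing a X with
  | zero =>
    have : t.IsLE X a := by simpa using hb'
    exact eulerCharacteristic_shift_of_pure hd a X this ha
  | succ n ih =>
    have hT := ExistsTriangle.truncation t (a + 1) X
    have h₁ : t.IsLE ((t.truncLT (a + 1)).obj X) a := t.isLE_truncLT_obj X (a + 1) a
    have h₂ : t.IsLE ((t.truncGE (a + 1)).obj X) (a + 1 + n) := by
      have : a + 1 + (n : ℤ) = a + ((n + 1 : ℕ) : ℤ) := by push_cast; ring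
      rw [this]; infer_instance
    have h₃ := eulerCharacteristic_shift_of_pure hd a _ h₁ inferInstance
    have bX : t.bounded ((t.truncLT (a + 1)).obj X) := ⟨⟨a, inferInstance⟩, ⟨a, h₁⟩⟩
    have bZ : t.bounded ((t.truncGE (a + 1)).obj X) := ⟨⟨a + 1, inferInstance⟩, ⟨_, h₂⟩⟩
    rw [eulerCharacteristic_trunc hd hT (a + 1) (by simpa using h₁) inferInstance bX bZ,
      eulerCharacteristic_trunc hd (hT.shift 1) a (t.isLE_shift _ a 1 (a - 1))
        (t.isGE_shift _ (a + 1) 1 a) (t.bounded.le_shift 1 _ bX) (t.bounded.le_shift 1 _ bZ),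
      ih (a + 1) inferInstance h₂, h₃, neg_add]

lemma isEulerFunction_eulerCharacteristic (hb : ∀ X, t.bounded X) :
    IsEulerFunction t (eulerCharacteristic t d) where
  trunc h n hX hZ := eulerCharacteristic_trunc hd h n hX hZ (hb _) (hb _)
  heart h hX hY hZ := by
    rw [eulerCharacteristic_of_heart hd hX, eulerCharacteristic_of_heart hd hY,
      eulerCharacteristic_of_heart hd hZ, hd.add h hX hY hZ]
  iso e := by
    rw [eulerCharacteristic, eulerCharacteristic]
    exact congrArg _ (funext fun i => eulerTerm_iso hd i ((t.truncGELT i (i + 1)).mapIso e))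
  shift X := eulerCharacteristic_shift hd (hb X)

/-- An additive function on the heart of a bounded t-structure extends to the Grothendieck group. -/
theorem IsHeartAdditive.exists_hom (hb : ∀ X, t.bounded X) :
    ∃ φ : TriangulatedK0 C →+ G, ∀ X, t.heart X → φ (k0Class X) = d X := by
  refine ⟨QuotientAddGroup.lift _ (FreeAbelianGroup.lift (eulerCharacteristic t d)) ?_,
    fun X hX => ?_⟩
  · rw [AddSubgroup.closure_le]
    rintro _ ⟨T, hT, rfl⟩
    have h := (isEulerFunction_eulerCharacteristic hd hb).additive (ExistsTriangle.of_mem hT) (hb _)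
    simp [h]
  · rw [← eulerCharacteristic_of_heart hd hX]
    exact (QuotientAddGroup.lift_mk' _ _ _).trans (FreeAbelianGroup.lift_apply_of _ _)

end EulerCharacteristic

end Devissage

/-! ### Nilpotent representations and their dimension vectors -/

namespace DoubledKronecker

/-- The linear map at a vertex given by a morphism of representations. -/
def Rep.appAt {M N : Rep} (f : M ⟶ N) (v : Vertex) : M.space v ⟶ N.space v := f.app _

lemma Rep.act_appAt {M N : Rep} (f : M ⟶ N) {v w : Vertex} (p : Quiver.Path v w) :
    M.act p ≫ Rep.appAt f w = Rep.appAt f v ≫ N.act p :=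
  f.naturality _

lemma Rep.hom_ext {M N : Rep} {f g : M ⟶ N} (h : ∀ v, Rep.appAt f v = Rep.appAt g v) : f = g :=
  NatTrans.ext (funext fun ⟨v⟩ => h v)

instance {M N : Rep} (f : M ⟶ N) [Mono f] (v : Vertex) : Mono (Rep.appAt f v) :=
  inferInstanceAs (Mono (f.app ((Quotient.functor Relation).obj ((Paths.of Vertex).obj v))))

instance {M N : Rep} (f : M ⟶ N) [Epi f] (v : Vertex) : Epi (Rep.appAt f v) :=
  inferInstanceAs (Epi (f.app ((Quotient.functor Relation).obj ((Paths.of Vertex).obj v))))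

lemma Rep.mono_of_mono_appAt {M N : Rep} (f : M ⟶ N) (h : ∀ v, Mono (Rep.appAt f v)) : Mono f := by
  have : ∀ v, Mono (f.app v) := fun ⟨v⟩ => h v
  exact NatTrans.mono_of_mono_app f

instance : IsNilpotentRep.IsClosedUnderSubobjects where
  prop_of_mono {M N} f _ := by
    rintro ⟨hN, n, hn⟩
    refine ⟨fun v => ?_, n, fun v w p hp => ?_⟩
    · have := hN v
      exact Module.Finite.of_injective (Rep.appAt f v).hom
        ((ModuleCat.mono_iff_injective (Rep.appAt f v)).1 inferInstance)
    · rw [← cancel_mono (Rep.appAt f w), Rep.act_appAt f p, hn v w p hp, comp_zero, zero_comp]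

instance : IsNilpotentRep.IsClosedUnderQuotients where
  prop_of_epi {M N} f _ := by
    rintro ⟨hM, n, hn⟩
    refine ⟨fun v => ?_, n, fun v w p hp => ?_⟩
    · have := hM v
      exact Module.Finite.of_surjective (Rep.appAt f v).hom
        ((ModuleCat.epi_iff_surjective (Rep.appAt f v)).1 inferInstance)
    · rw [← cancel_epi (Rep.appAt f v), ← Rep.act_appAt f p, hn v w p hp, zero_comp, comp_zero]

instance : IsNilpotentRep.IsClosedUnderFiniteProducts where
  isClosedUnderLimitsOfShape J _ := by
    refine ⟨?_⟩
    rintro X ⟨p⟩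
    have hJ := fun j : Discrete J => p.prop_diag_obj j
    have hlim (v : Vertex) := isLimitOfPreserves ((evaluation _ (ModuleCat.{0} ℂ)).obj
      ((Quotient.functor Relation).obj ((Paths.of Vertex).obj v))) p.isLimit
    let pr (j : Discrete J) : X ⟶ p.diag.obj j := p.π.app j
    choose fd n hn using hJ
    cases nonempty_fintype J
    -- Any common bound for the nilpotency orders of the factors works; the sum is one.
    refine ⟨fun v => ?_, ∑ j : J, n ⟨j⟩, fun v w q hq => ?_⟩
    · let φ : X.space v →ₗ[ℂ] ∀ j : J, (p.diag.obj ⟨j⟩).space v :=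
        LinearMap.pi fun j => (Rep.appAt (pr ⟨j⟩) v).hom
      have := fun j : J => fd ⟨j⟩ v
      refine Module.Finite.of_injective φ fun x y hxy => ?_
      refine Concrete.isLimit_ext _ (hlim v) x y fun ⟨j⟩ => ?_
      exact congrFun hxy j
    · have key (j : Discrete J) : X.act q ≫ Rep.appAt (pr j) w = 0 := by
        rw [Rep.act_appAt (pr j) q, hn j v w q ((Finset.single_le_sum (f := fun j : J => n ⟨j⟩)
          (fun _ _ => Nat.zero_le _) (Finset.mem_univ j.as)).trans hq), comp_zero]
      exact (hlim w).hom_ext fun j => (key j).trans zero_comp.symm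

/-- The functor `M ↦ M_v`. -/
noncomputable def spaceFunctor (v : Vertex) : NilRep ⥤ ModuleCat.{0} ℂ :=
  IsNilpotentRep.ι ⋙ (evaluation _ _).obj
    ((Quotient.functor Relation).obj ((Paths.of Vertex).obj v))

instance (v : Vertex) : (spaceFunctor v).PreservesZeroMorphisms where
  map_zero _ _ := rfl

/-- The dimension of a nilpotent representation at a vertex. -/
noncomputable def dim (v : Vertex) (M : NilRep) : ℕ := Module.finrank ℂ (M.obj.space v)

instance (v : Vertex) (M : NilRep) : FiniteDimensional ℂ ((spaceFunctor v).obj M) :=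
  M.property.1 v

lemma dim_iso (v : Vertex) {M N : NilRep} (e : M ≅ N) : dim v M = dim v N :=
  ((spaceFunctor v).mapIso e).toLinearEquiv.finrank_eq

/-- Evaluation at a vertex is exact, because kernels and cokernels of nilpotent representations are
computed among all representations. -/
lemma dim_add (v : Vertex) {A B D : NilRep} (f : A ⟶ B) (g : B ⟶ D) (w : f ≫ g = 0)
    (hf : IsLimit (KernelFork.ofι f w)) (hg : IsColimit (CokernelCofork.ofπ g w)) :
    dim v B = dim v A + dim v D := by
  have := IsNilpotentRep.preservesKernels_ι g
  have := IsNilpotentRep.preservesCokernels_ι f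
  have : PreservesLimit (parallelPair g 0) (spaceFunctor v) := by
    unfold spaceFunctor
    have : PreservesLimit (parallelPair g 0 ⋙ IsNilpotentRep.ι) ((evaluation _
        (ModuleCat.{0} ℂ)).obj ((Quotient.functor Relation).obj ((Paths.of Vertex).obj v))) :=
      inferInstance
    infer_instance
  have : PreservesColimit (parallelPair f 0) (spaceFunctor v) := by
    unfold spaceFunctor
    infer_instance
  have h₁ := KernelFork.mapIsLimit _ hf (spaceFunctor v)
  have h₂ := CokernelCofork.mapIsColimit _ hg (spaceFunctor v)
  let S : ShortComplex (ModuleCat.{0} ℂ) := ShortComplex.mk ((spaceFunctor v).map f)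
    ((spaceFunctor v).map g) (by rw [← Functor.map_comp, w, Functor.map_zero])
  have hS : S.ShortExact :=
    { exact := S.exact_of_f_is_kernel h₁
      mono_f := mono_of_isLimit_fork h₁
      epi_g := epi_of_isColimit_cofork h₂ }
  have : FiniteDimensional ℂ S.X₁ := inferInstanceAs (FiniteDimensional ℂ ((spaceFunctor v).obj A))
  have : FiniteDimensional ℂ S.X₃ := inferInstanceAs (FiniteDimensional ℂ ((spaceFunctor v).obj D))
  exact ModuleCat.free_shortExact_finrank_add hS rfl rfl

lemma isZero_of_dim_eq_zero {M : NilRep} (hs : dim Vertex.s M = 0) (ht : dim Vertex.t M = 0) :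
    IsZero M := by
  have h : ∀ v, Subsingleton (M.obj.space v) := by
    have (v : Vertex) (hv : dim v M = 0) : Subsingleton (M.obj.space v) := by
      have := M.property.1 v
      exact Module.finrank_zero_iff.1 hv
    rintro (_ | _)
    · exact this _ hs
    · exact this _ ht
  rw [IsZero.iff_id_eq_zero]
  refine ObjectProperty.hom_ext _ (Rep.hom_ext fun v => ?_)
  ext x
  exact (h v).elim _ _

lemma dim_pos {M : NilRep} (hM : ¬ IsZero M) : 0 < dim Vertex.s M + dim Vertex.t M := by
  by_contra h
  exact hM (isZero_of_dim_eq_zero (by omega) (by omega))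

lemma dim_of_isZero (v : Vertex) {M : NilRep} (hM : IsZero M) : dim v M = 0 := by
  have h : IsZero ((spaceFunctor v).obj M) := (spaceFunctor v).map_isZero hM
  have : Subsingleton (M.obj.space v) := ModuleCat.subsingleton_of_isZero h
  exact Module.finrank_zero_of_subsingleton

lemma isZero_iff_dim {M : NilRep} : IsZero M ↔ dim Vertex.s M + dim Vertex.t M = 0 :=
  ⟨fun h => by rw [dim_of_isZero _ h, dim_of_isZero _ h],
    fun h => isZero_of_dim_eq_zero (by omega) (by omega)⟩

lemma Rep.act_nil (M : Rep) (v : Vertex) : M.act (Quiver.Path.nil : Quiver.Path v v) = 𝟙 _ :=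
  (Quotient.functor Relation ⋙ M).map_id ((Paths.of Vertex).obj v)

lemma Rep.act_cons (M : Rep) {u v w : Vertex} (p : Quiver.Path u v) (e : Arrow v w) :
    M.act (p.cons e) = M.act p ≫ M.act (Quiver.Hom.toPath e) :=
  (Quotient.functor Relation ⋙ M).map_comp (X := (Paths.of Vertex).obj u)
    (Y := (Paths.of Vertex).obj v) (Z := (Paths.of Vertex).obj w) p (Quiver.Hom.toPath e)

/-- A morphism of representations from compatible linear maps. -/
noncomputable def homMk {M N : Rep} (φ : ∀ v, M.space v ⟶ N.space v)
    (h : ∀ {v w : Vertex} (e : Arrow v w),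
      M.act (Quiver.Hom.toPath e) ≫ φ w = φ v ≫ N.act (Quiver.Hom.toPath e)) : M ⟶ N :=
  have key {v w : Vertex} (p : Quiver.Path v w) : M.act p ≫ φ w = φ v ≫ N.act p := by
    induction p with
    | nil => rw [Rep.act_nil, Rep.act_nil, Category.id_comp, Category.comp_id]
    | cons p e ih => rw [Rep.act_cons, Rep.act_cons, Category.assoc, h, reassoc_of% ih]
  Quotient.natTransLift Relation
    { app := fun v => φ v
      naturality := fun _ _ p => key p }

lemma act_simple (v : Vertex) {u w : Vertex} (e : Arrow u w) :
    (simple v).obj.act (Quiver.Hom.toPath e) = 0 :=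
  Category.id_comp (obj := ModuleCat.{0} ℂ) _

lemma dim_simple (v w : Vertex) [Decidable (v = w)] :
    dim w (simple v) = if v = w then 1 else 0 := by
  cases v <;> cases w
  · exact (Module.finrank_self ℂ).trans (by simp)
  · exact (Module.finrank_zero_of_subsingleton (M := PUnit)).trans (by simp)
  · exact (Module.finrank_zero_of_subsingleton (M := PUnit)).trans (by simp)
  · exact (Module.finrank_self ℂ).trans (by simp)

lemma dim_pointObj (y : ℂ × ℂ) (w : Vertex) : dim w (pointObj y) = 1 :=
  Module.finrank_self ℂ

/-- `a'` acts as the identity and the other arrows by zero. -/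
def reverseMap : ∀ v w, Arrow v w → (ModuleCat.of ℂ ℂ ⟶ ModuleCat.of ℂ ℂ)
  | _, _, Arrow.a' => 𝟙 _
  | _, _, _ => 0

lemma reverseMap_comp {u v w : Vertex} (e : Arrow u v) (e' : Arrow v w) :
    reverseMap u v e ≫ reverseMap v w e' = 0 := by
  cases e <;> cases e' <;> simp [reverseMap]

/-- The representation with a copy of `ℂ` at each vertex, on which only `a'` acts nontrivially. -/
def reverseRep : Rep :=
  mkRep (fun _ => ModuleCat.of ℂ ℂ) reverseMap
    ((reverseMap_comp _ _).trans (reverseMap_comp _ _).symm)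
    ((reverseMap_comp _ _).trans (reverseMap_comp _ _).symm)

lemma isNilpotentRep_reverseRep : IsNilpotentRep reverseRep := by
  refine ⟨fun w => inferInstanceAs (FiniteDimensional ℂ ℂ), 2, fun u w p hp => ?_⟩
  cases p with
  | nil => simp at hp
  | cons q e =>
    cases q with
    | nil => simp at hp
    | cons r e' =>
      refine (Category.assoc (obj := ModuleCat ℂ) _ (reverseMap _ _ e')
        (reverseMap _ _ e)).trans ?_
      rw [reverseMap_comp]
      exact comp_zero (C := ModuleCat ℂ)

/-- The nilpotent representation with a copy of `ℂ` at each vertex, on which only `a'` acts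
nontrivially. -/
def reverseObj : NilRep := ⟨reverseRep, isNilpotentRep_reverseRep⟩

lemma dim_reverseObj (w : Vertex) : dim w reverseObj = 1 := Module.finrank_self ℂ

/-- Since a' is injective on `reverseObj`, naturality along a' determines the component of `f` at t
from the one at s. -/
lemma hom_reverseObj_eq_zero {M : NilRep} (hM : dim Vertex.s M = 0) (f : M ⟶ reverseObj) :
    f = 0 := by
  have := M.property.1 Vertex.s
  have hs : Subsingleton (M.obj.space Vertex.s) := Module.finrank_zero_iff.1 hM
  have hn := Rep.act_appAt f.hom (Quiver.Hom.toPath (V := Vertex) Arrow.a')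
  have ha : reverseObj.obj.act (Quiver.Hom.toPath (V := Vertex) Arrow.a') =
    𝟙 (ModuleCat.of ℂ ℂ) := Category.id_comp (obj := ModuleCat.{0} ℂ) _
  have h₀ : Rep.appAt f.hom Vertex.s = 0 := by
    ext x
    rw [hs.elim x 0, map_zero, map_zero]
  refine ObjectProperty.hom_ext _ (Rep.hom_ext fun v => ?_)
  cases v with
  | s => exact h₀
  | t =>
    rw [h₀, comp_zero, ha] at hn
    exact (Category.comp_id _).symm.trans hn.symm

/-- A nonzero vector which is killed by all arrows gives a subrepresentation. -/
lemma exists_mono_simple_of_vector {M : NilRep} (v : Vertex) (y : M.obj.space v) (hy : y ≠ 0)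
    (h : ∀ {w : Vertex} (e : Arrow v w), M.obj.act (Quiver.Hom.toPath e) y = 0) :
    ∃ f : simple v ⟶ M, Mono f := by
  obtain ⟨φ, hφ, hφ'⟩ : ∃ φ : ∀ w, (simple v).obj.space w ⟶ M.obj.space w, (∀ w, Mono (φ w)) ∧
      ∀ {u w : Vertex} (e : Arrow u w), φ u ≫ M.obj.act (Quiver.Hom.toPath e) = 0 := by
    have hmono : Mono (ModuleCat.ofHom (LinearMap.toSpanSingleton ℂ (M.obj.space v) y)) := by
      rw [ModuleCat.mono_iff_injective]
      exact LinearMap.ker_eq_bot.1 (LinearMap.ker_toSpanSingleton ℂ hy)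
    have hker {w : Vertex} (e : Arrow v w) :
        ModuleCat.ofHom (LinearMap.toSpanSingleton ℂ (M.obj.space v) y) ≫
          M.obj.act (Quiver.Hom.toPath e) = 0 := by
      ext
      simpa using h e
    have hzero (V : ModuleCat.{0} ℂ) : Mono (0 : ModuleCat.of ℂ PUnit.{1} ⟶ V) := by
      rw [ModuleCat.mono_iff_injective]
      exact fun x y _ => Subsingleton.elim (α := PUnit) x y
    cases v with
    | s =>
      refine ⟨fun w => match w with
        | Vertex.s => ModuleCat.ofHom (LinearMap.toSpanSingleton ℂ _ y)
        | Vertex.t => (0 : ModuleCat.of ℂ PUnit.{1} ⟶ _), fun w => ?_, fun {u w} e => ?_⟩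
      · cases w
        · exact hmono
        · exact hzero _
      · cases u
        · exact hker e
        · exact zero_comp
    | t =>
      refine ⟨fun w => match w with
        | Vertex.t => ModuleCat.ofHom (LinearMap.toSpanSingleton ℂ _ y)
        | Vertex.s => (0 : ModuleCat.of ℂ PUnit.{1} ⟶ _), fun w => ?_, fun {u w} e => ?_⟩
      · cases w
        · exact hzero _
        · exact hmono
      · cases u
        · exact zero_comp
        · exact hker e
  refine ⟨ObjectProperty.homMk (homMk φ fun e => ?_), ?_⟩
  · rw [hφ' e]
    rw [act_simple, zero_comp]
  · refine IsNilpotentRep.ι.mono_of_mono_map ?_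
    exact Rep.mono_of_mono_appAt _ hφ

/-- A nonzero nilpotent representation has a simple subrepresentation. -/
lemma exists_mono_simple {M : NilRep} (hM : ¬ IsZero M) :
    ∃ (v : Vertex) (f : simple v ⟶ M), Mono f := by
  obtain ⟨n, hn⟩ := M.property.2
  let P : ℕ → Prop := fun k => ∃ (v w : Vertex) (p : Quiver.Path v w),
    p.length = k ∧ M.obj.act p ≠ 0
  have hP : ∃ k, P k := by
    by_contra! h
    refine hM ?_
    rw [IsZero.iff_id_eq_zero]
    refine ObjectProperty.hom_ext _ (Rep.hom_ext fun v => ?_)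
    by_contra hv
    refine h 0 ⟨v, v, Quiver.Path.nil, rfl, fun h0 => hv ?_⟩
    exact (M.obj.map_id _).symm.trans h0
  have hbd : ∀ k, P k → k ≤ n := fun k ⟨v, w, p, hp, hp'⟩ => by
    by_contra h
    exact hp' (hn v w p (by omega))
  classical
  obtain ⟨k₀, hk₀⟩ := hP
  -- A longest path with nonzero action, which exists by nilpotency: every further arrow kills its
  -- image, so a nonzero vector of the image spans a simple subrepresentation.
  obtain ⟨u, v, p, hp, hp'⟩ := Nat.findGreatest_spec (P := P) (hbd k₀ hk₀) hk₀
  have hkill : ∀ {w : Vertex} (e : Arrow v w), M.obj.act p ≫ M.obj.act (Quiver.Hom.toPath e) = 0 := by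
    intro w e
    by_contra h
    have hc : P (Nat.findGreatest P n + 1) := by
      refine ⟨u, w, p.cons e, by simp [hp], fun h0 => h ?_⟩
      exact (M.obj.map_comp _ _).symm.trans h0
    have := Nat.le_findGreatest (hbd _ hc) hc
    omega
  obtain ⟨x, hx⟩ : ∃ x, M.obj.act p x ≠ 0 := by
    by_contra! h
    exact hp' (by ext x; exact h x)
  obtain ⟨f, hf⟩ := exists_mono_simple_of_vector v _ hx
    fun e => ConcreteCategory.congr_hom (hkill e) x
  exact ⟨v, f, hf⟩

end DoubledKronecker

namespace DoubledKronecker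

instance {M N : NilRep} (f : M ⟶ N) : PreservesLimit (parallelPair f 0) IsNilpotentRep.ι :=
  IsNilpotentRep.preservesKernels_ι f

instance {M N : NilRep} (f : M ⟶ N) : PreservesColimit (parallelPair f 0) IsNilpotentRep.ι :=
  IsNilpotentRep.preservesCokernels_ι f

instance {M N : NilRep} (f : M ⟶ N) : IsIso (Abelian.coimageImageComparison f) :=
  have := IsIso.of_isIso_fac_right (Abelian.PreservesCoimage.hom_coimageImageComparison
    IsNilpotentRep.ι f).symm
  isIso_of_reflects_iso _ IsNilpotentRep.ι

noncomputable instance : Abelian NilRep := Abelian.ofCoimageImageComparisonIsIso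

lemma dim_of_shortExact (v : Vertex) {S : ShortComplex NilRep} (hS : S.ShortExact) :
    dim v S.X₂ = dim v S.X₁ + dim v S.X₃ :=
  have := hS.mono_f
  have := hS.epi_g
  dim_add v S.f S.g S.zero hS.fIsKernel hS.gIsCokernel

end DoubledKronecker

/-! ### Short exact sequences of the heart as distinguished triangles -/

section Heart
variable {C : Type u} [Category.{v} C] [Preadditive C] [HasZeroObject C] [HasShift C ℤ]
  [∀ n : ℤ, (shiftFunctor C n).Additive] [Pretriangulated C] (t : TStructure C)
  {H : Type*} [Category H] [Preadditive H] [t.Heart H]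

lemma exists_iso_ιHeart {X : C} (hX : t.heart X) : ∃ M : H, Nonempty (X ≅ t.ιHeart.obj M) := by
  rw [← t.essImage_ιHeart H] at hX
  obtain ⟨M, ⟨e⟩⟩ := hX
  exact ⟨M, ⟨e.symm⟩⟩

lemma ιHeart_hom_shift_eq_zero ⦃X Y : H⦄ ⦃n : ℤ⦄ (f : t.ιHeart.obj X ⟶ (t.ιHeart.obj Y)⟦n⟧)
    (hn : n < 0) : f = 0 :=
  have := t.isGE_shift (t.ιHeart.obj Y) 0 n (-n)
  t.zero f 0 (-n)

variable [IsTriangulated C]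

/-- The cone of a morphism of the heart lives in degrees -1 and 0. Its truncation triangle exhibits
the kernel, shifted by one, and the cokernel. -/
lemma ιHeart_admissible :
    Triangulated.AbelianSubcategory.admissibleMorphism (t.ιHeart (H := H)) = ⊤ := by
  rw [eq_top_iff]
  intro X₁ X₂ f₁ _ X₃ f₂ f₃ hT
  have hX : ExistsTriangle _ _ _ := ⟨_, _, _, hT⟩
  have h₁ : t.IsGE X₃ (-1) := hX.rotate.isGE₂ t (-1) (t.isGE_of_ge _ (-1) 0)
    (t.isGE_shift _ 0 1 (-1))
  have h₂ : t.IsLE X₃ 0 := hX.rotate.isLE₂ t 0 inferInstance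
    (have := t.isLE_shift (t.ιHeart.obj X₁) 0 1 (-1); t.isLE_of_le _ (-1) 0)
  have h₃ : t.IsLE ((t.truncLT 0).obj X₃) (-1) := t.isLE_truncLT_obj X₃ 0 (-1)
  obtain ⟨K, ⟨eK⟩⟩ := exists_iso_ιHeart (H := H) t (X := ((t.truncLT 0).obj X₃)⟦(-1 : ℤ)⟧)
    ((t.mem_heart_iff _).2 ⟨t.isLE_shift _ (-1) (-1) 0, t.isGE_shift _ (-1) (-1) 0⟩)
  obtain ⟨Q, ⟨eQ⟩⟩ := exists_iso_ιHeart (H := H) t (X := (t.truncGE 0).obj X₃)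
    ((t.mem_heart_iff _).2 ⟨inferInstance, inferInstance⟩)
  obtain ⟨α, β, γ, h⟩ := (ExistsTriangle.truncation t 0 X₃).of_iso
    (((shiftEquiv C (1 : ℤ)).counitIso.app _).symm ≪≫ (shiftFunctor C (1 : ℤ)).mapIso eK)
    (Iso.refl _) eQ
  exact ⟨K, Q, α, β, γ, h⟩

lemma exists_triangle_of_epi {M N : H} (g : M ⟶ N) [Epi g] :
    ∃ (K : H) (i : K ⟶ M) (δ : t.ιHeart.obj N ⟶ (t.ιHeart.obj K)⟦(1 : ℤ)⟧),
      Triangle.mk (t.ιHeart.map i) (t.ιHeart.map g) δ ∈ distTriang C :=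
  Triangulated.AbelianSubcategory.exists_distinguished_triangle_of_epi
    (ιHeart_hom_shift_eq_zero t) (ιHeart_admissible t) g

end Heart

section Heart
variable {C : Type u} [Category.{v} C] [Preadditive C] [HasZeroObject C] [HasShift C ℤ]
  [∀ n : ℤ, (shiftFunctor C n).Additive] [Pretriangulated C] (t : TStructure C)
  {H : Type*} [Category H] [Abelian H] [t.Heart H]

lemma shortExact_of_triangle {X₁ X₂ X₃ : H} (f₁ : X₁ ⟶ X₂) (f₂ : X₂ ⟶ X₃)
    (f₃ : t.ιHeart.obj X₃ ⟶ (t.ιHeart.obj X₁)⟦(1 : ℤ)⟧)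
    (hT : Triangle.mk (t.ιHeart.map f₁) (t.ιHeart.map f₂) f₃ ∈ distTriang C) :
    ∃ w : f₁ ≫ f₂ = 0, (ShortComplex.mk f₁ f₂ w).ShortExact := by
  have h₁ := Triangulated.AbelianSubcategory.isLimitKernelForkOfDistTriang
    (ιHeart_hom_shift_eq_zero t) f₁ f₂ f₃ hT
  have h₂ := Triangulated.AbelianSubcategory.isColimitCokernelCoforkOfDistTriang
    (ιHeart_hom_shift_eq_zero t) f₁ f₂ f₃ hT
  refine ⟨t.ιHeart.map_injective ?_,
    { exact := ShortComplex.exact_of_f_is_kernel _ h₁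
      mono_f := mono_of_isLimit_fork h₁
      epi_g := epi_of_isColimit_cofork h₂ }⟩
  rw [Functor.map_comp, Functor.map_zero]
  exact comp_distTriang_mor_zero₁₂ _ hT

variable [IsTriangulated C]

/-- The epimorphism already sits in a triangle whose first vertex is a kernel; uniqueness of kernels
identifies that vertex with the given one. -/
lemma exists_triangle_of_shortExact {S : ShortComplex H} (hS : S.ShortExact) :
    ∃ δ : t.ιHeart.obj S.X₃ ⟶ (t.ιHeart.obj S.X₁)⟦(1 : ℤ)⟧,
      Triangle.mk (t.ιHeart.map S.f) (t.ιHeart.map S.g) δ ∈ distTriang C := by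
  have := hS.epi_g
  have := hS.mono_f
  obtain ⟨K, i, δ, hT⟩ := exists_triangle_of_epi t S.g
  obtain ⟨w, h⟩ := shortExact_of_triangle t i S.g δ hT
  have := h.mono_f
  let e : S.X₁ ≅ K := IsLimit.conePointUniqueUpToIso hS.fIsKernel h.fIsKernel
  have he : e.hom ≫ i = S.f :=
    IsLimit.conePointUniqueUpToIso_hom_comp hS.fIsKernel h.fIsKernel WalkingParallelPair.zero
  refine ⟨δ ≫ (t.ιHeart.map e.inv)⟦(1 : ℤ)⟧', isomorphic_distinguished _ hT _
    (Triangle.isoMk _ _ (t.ιHeart.mapIso e) (Iso.refl _) (Iso.refl _) ?_ ?_ ?_)⟩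
  · change t.ιHeart.map S.f ≫ 𝟙 _ = t.ιHeart.map e.hom ≫ t.ιHeart.map i
    rw [Category.comp_id, ← Functor.map_comp, he]
  · change t.ιHeart.map S.g ≫ 𝟙 _ = 𝟙 _ ≫ t.ιHeart.map S.g
    simp
  · change (δ ≫ (t.ιHeart.map e.inv)⟦(1 : ℤ)⟧') ≫ (t.ιHeart.map e.hom)⟦(1 : ℤ)⟧' = 𝟙 _ ≫ δ
    rw [Category.assoc, ← Functor.map_comp, ← Functor.map_comp, e.inv_hom_id]
    simp
end Heart

/-! ### Slope semistability and destabilizing quotients -/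

/-- The slope of the dimension vector `(a, b)`. -/
def dimSlope (a b : ℕ) : ℚ := b / (a + b)

lemma dimSlope_lt_iff {a b c d : ℕ} (h : 0 < a + b) (h' : 0 < c + d) :
    dimSlope a b < dimSlope c d ↔ b * c < d * a := by
  rw [dimSlope, dimSlope, div_lt_div_iff₀ (by exact_mod_cast h) (by exact_mod_cast h')]
  norm_cast
  constructor <;> intro h <;> nlinarith

lemma dimSlope_le_iff {a b c d : ℕ} (h : 0 < a + b) (h' : 0 < c + d) :
    dimSlope a b ≤ dimSlope c d ↔ b * c ≤ d * a := by
  rw [← not_lt, dimSlope_lt_iff h' h, not_lt]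

namespace DoubledKronecker

/-- The slope of a representation. -/
noncomputable def slope (M : NilRep) : ℚ := dimSlope (dim Vertex.s M) (dim Vertex.t M)

lemma slope_lt_iff {M N : NilRep} (hM : ¬ IsZero M) (hN : ¬ IsZero N) :
    slope M < slope N ↔ dim Vertex.t M * dim Vertex.s N < dim Vertex.t N * dim Vertex.s M :=
  dimSlope_lt_iff (dim_pos hM) (dim_pos hN)

lemma slope_le_iff {M N : NilRep} (hM : ¬ IsZero M) (hN : ¬ IsZero N) :
    slope M ≤ slope N ↔ dim Vertex.t M * dim Vertex.s N ≤ dim Vertex.t N * dim Vertex.s M :=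
  dimSlope_le_iff (dim_pos hM) (dim_pos hN)

/-- A nonzero representation is slope semistable if the slopes of its nonzero quotients are not
smaller than its own. -/
def IsSlopeSemistable (M : NilRep) : Prop :=
  ¬ IsZero M ∧ ∀ ⦃R : NilRep⦄ (g : M ⟶ R), Epi g → ¬ IsZero R → slope M ≤ slope R

lemma dim_of_epi (v : Vertex) {M R : NilRep} (g : M ⟶ R) [Epi g] :
    dim v M = dim v (kernel g) + dim v R :=
  dim_of_shortExact v (S := ShortComplex.mk (kernel.ι g) g (by simp))
    { exact := ShortComplex.exact_of_f_is_kernel _ (kernelIsKernel g) }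

lemma dim_of_mono (v : Vertex) {M N : NilRep} (f : M ⟶ N) [Mono f] :
    dim v N = dim v M + dim v (cokernel f) :=
  dim_of_shortExact v (S := ShortComplex.mk f (cokernel.π f) (by simp))
    { exact := ShortComplex.exact_of_g_is_cokernel _ (cokernelIsCokernel f) }

/-- The image of a nonzero map is a quotient of `M`, so its slope is at least that of `M`. It is
also a subobject of `N`, and semistability of `N`, read on the cokernel, bounds its slope by that of
`N`. -/
lemma IsSlopeSemistable.hom_eq_zero {M N : NilRep} (hM : IsSlopeSemistable M)
    (hN : IsSlopeSemistable N) (h : slope N < slope M) (f : M ⟶ N) : f = 0 := by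
  by_contra hf
  have hI : ¬ IsZero (Abelian.image f) := fun hI => hf (by
    rw [← Abelian.image.fac f, hI.eq_zero_of_tgt (Abelian.factorThruImage f), zero_comp])
  have h₁ := hM.2 (Abelian.factorThruImage f) inferInstance hI
  have hs := dim_of_mono Vertex.s (Abelian.image.ι f)
  have ht := dim_of_mono Vertex.t (Abelian.image.ι f)
  refine absurd (h.trans_le h₁) (not_lt.2 ?_)
  rw [slope_le_iff hI hN.1, hs, ht]
  by_cases hR : IsZero (cokernel (Abelian.image.ι f))
  · rw [dim_of_isZero _ hR, dim_of_isZero _ hR, add_zero, add_zero]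
  · have h₂ := hN.2 (cokernel.π (Abelian.image.ι f)) inferInstance hR
    rw [slope_le_iff hN.1 hR, hs, ht] at h₂
    linarith

/-- The maximal destabilizing quotient. -/
lemma exists_destabilizing_quotient {E : NilRep} (hE : ¬ IsZero E) :
    ∃ (Q : NilRep) (g : E ⟶ Q), Epi g ∧ IsSlopeSemistable Q ∧
      ∀ ⦃P : NilRep⦄ (h : kernel g ⟶ P), Epi h → ¬ IsZero P → slope Q < slope P := by
  let S : Set (ℕ × ℕ) := {x | ∃ (R : NilRep) (g : E ⟶ R), Epi g ∧ ¬ IsZero R ∧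
    x = (dim Vertex.s R, dim Vertex.t R)}
  have hfin : S.Finite := by
    refine ((Set.finite_Iic (dim Vertex.s E)).prod (Set.finite_Iic (dim Vertex.t E))).subset ?_
    rintro _ ⟨R, g, _, _, rfl⟩
    exact ⟨by rw [Set.mem_Iic, dim_of_epi Vertex.s g]; omega,
      by rw [Set.mem_Iic, dim_of_epi Vertex.t g]; omega⟩
  -- Lexicographic minimum: the least slope among the quotients and, for that slope, the largest
  -- total dimension.
  obtain ⟨_, ⟨Q, g, hg, hQ, rfl⟩, hmin⟩ := Set.exists_min_image S
    (fun x => toLex (dimSlope x.1 x.2, -((x.1 + x.2 : ℕ) : ℤ))) hfin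
    ⟨_, E, 𝟙 E, inferInstance, hE, rfl⟩
  have hmin' : ∀ (R : NilRep) (h : E ⟶ R), Epi h → ¬ IsZero R → slope Q < slope R ∨
      (slope Q = slope R ∧ dim Vertex.s R + dim Vertex.t R ≤ dim Vertex.s Q + dim Vertex.t Q) := by
    intro R h hh hR
    have := hmin _ ⟨R, h, hh, hR, rfl⟩
    rw [Prod.Lex.toLex_le_toLex] at this
    refine this.imp id fun ⟨h₁, h₂⟩ => ⟨h₁, ?_⟩
    dsimp only at h₂
    omega
  refine ⟨Q, g, hg, ⟨hQ, fun R h _ hR => ?_⟩, fun P h _ hP => ?_⟩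
  · rcases hmin' R (g ≫ h) (epi_comp g h) hR with h' | h'
    · exact h'.le
    · exact h'.1.le
  -- The quotient `M` of `E` by the kernel of `h` has the dimension vector of `P` plus that of `Q`.
  -- If the slope of `P` were at most that of `Q`, then `M` would have slope at most that of `Q` and
  -- larger dimension, against the choice of `Q`.
  · have hs := dim_of_mono Vertex.s (kernel.ι h ≫ kernel.ι g)
    have ht := dim_of_mono Vertex.t (kernel.ι h ≫ kernel.ι g)
    set M := cokernel (kernel.ι h ≫ kernel.ι g)
    have hs' : dim Vertex.s M = dim Vertex.s P + dim Vertex.s Q := by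
      have := dim_of_epi Vertex.s g
      have := dim_of_epi Vertex.s h
      omega
    have ht' : dim Vertex.t M = dim Vertex.t P + dim Vertex.t Q := by
      have := dim_of_epi Vertex.t g
      have := dim_of_epi Vertex.t h
      omega
    have hP' := dim_pos hP
    have hM : ¬ IsZero M := fun hM => by
      have := isZero_iff_dim.1 hM
      omega
    by_contra hlt
    rw [not_lt, slope_le_iff hP hQ] at hlt
    have hle : slope M ≤ slope Q := by
      rw [slope_le_iff hM hQ, hs', ht']
      linarith
    rcases hmin' M (cokernel.π _) inferInstance hM with h' | h'
    · exact absurd h' (not_lt.2 hle)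
    · omega

lemma isSlopeSemistable_simple (v : Vertex) : IsSlopeSemistable (simple v) := by
  classical
  refine ⟨fun h => ?_, fun R g _ hR => ?_⟩
  · have := isZero_iff_dim.1 h
    rw [dim_simple, dim_simple] at this
    cases v <;> simp at this
  · have hs := dim_of_epi Vertex.s g
    have ht := dim_of_epi Vertex.t g
    have hR := dim_pos hR
    rw [dim_simple] at hs ht
    have : dim Vertex.s (simple v) = dim Vertex.s R ∧ dim Vertex.t (simple v) = dim Vertex.t R := by
      rw [dim_simple, dim_simple]
      cases v <;> simp at hs ht ⊢ <;> omega
    rw [slope, slope, this.1, this.2]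

/-- A semistable object of charge 1 is needed later. The representations R_y do not serve: their
quotient S_s has slope 0. With the arrow reversed, a destabilizing quotient would have a kernel
supported at t, and such a kernel maps to `reverseObj` by zero. -/
lemma isSlopeSemistable_reverseObj : IsSlopeSemistable reverseObj := by
  have h0 : ¬ IsZero reverseObj := fun h => by
    have := isZero_iff_dim.1 h
    rw [dim_reverseObj, dim_reverseObj] at this
    omega
  refine ⟨h0, fun R g _ hR => ?_⟩
  by_contra hlt
  rw [slope_le_iff h0 hR, dim_reverseObj, dim_reverseObj] at hlt
  have hs := dim_of_epi Vertex.s g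
  have ht := dim_of_epi Vertex.t g
  rw [dim_reverseObj] at hs ht
  have hk := hom_reverseObj_eq_zero (by omega) (kernel.ι g)
  have := dim_of_isZero Vertex.t (IsZero.of_mono_eq_zero _ hk)
  omega

end DoubledKronecker

/-! ### Arguments of the central charges -/

section Charge

lemma arg_div_eq_sub {x y : ℂ} (hx : x ≠ 0) (hy : y ≠ 0)
    (h : |Complex.arg x - Complex.arg y| < Real.pi) :
    Complex.arg (x / y) = Complex.arg x - Complex.arg y := by
  have h1 := Complex.arg_div_coe_angle hx hy
  rw [← Real.Angle.coe_sub] at h1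
  have h2 := congrArg Real.Angle.toReal h1
  rw [abs_lt] at h
  rwa [Complex.arg_coe_angle_toReal_eq_arg,
    Real.Angle.toReal_coe_eq_self_iff.2 ⟨h.1, h.2.le⟩] at h2

/-- The central charge of the dimension vector `(a, b)` for the period `w`. -/
noncomputable def dimCharge (w : ℂ) (a b : ℕ) : ℂ := a * (1 - w) + b * w

variable {w : ℂ} {a b c d : ℕ}

lemma dimCharge_im (w : ℂ) (a b : ℕ) : (dimCharge w a b).im = ((b : ℝ) - a) * w.im := by
  simp [dimCharge]; ring

lemma dimCharge_re (w : ℂ) (a b : ℕ) : (dimCharge w a b).re = a + ((b : ℝ) - a) * w.re := by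
  simp [dimCharge]; ring

lemma dimCharge_ne_zero (hw : 0 < w.im) (h : 0 < a + b) : dimCharge w a b ≠ 0 := by
  intro h0
  have h1 := dimCharge_im w a b
  have h2 := dimCharge_re w a b
  rw [h0, Complex.zero_im, zero_eq_mul, or_iff_left hw.ne'] at h1
  rw [h0, h1, Complex.zero_re, zero_mul, add_zero] at h2
  have h3 : a = 0 := by exact_mod_cast h2.symm
  subst h3
  have h4 : b = 0 := by
    have : (b : ℝ) = 0 := by simpa using h1
    exact_mod_cast this
  omega

/-- The charge is real only for a = b, and then it equals a ≥ 0. Hence the branch cut of the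
argument is never met. -/
lemma arg_dimCharge_lt_pi (hw : 0 < w.im) :
    Complex.arg (dimCharge w a b) < Real.pi := by
  refine lt_of_le_of_ne (Complex.arg_le_pi _) fun h' => ?_
  obtain ⟨h1, h2⟩ := Complex.arg_eq_pi_iff.1 h'
  rw [dimCharge_im, mul_eq_zero, or_iff_left hw.ne'] at h2
  rw [dimCharge_re, h2, zero_mul, add_zero] at h1
  exact absurd h1 (not_lt.2 (Nat.cast_nonneg a))

lemma arg_dimCharge_nonneg_iff (hw : 0 < w.im) :
    0 ≤ Complex.arg (dimCharge w a b) ↔ a ≤ b := by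
  rw [Complex.arg_nonneg_iff, dimCharge_im, mul_nonneg_iff_of_pos_right hw, sub_nonneg,
    Nat.cast_le]

lemma dimCharge_cross (w : ℂ) (a b c d : ℕ) :
    (dimCharge w c d / dimCharge w a b).im =
      ((a : ℝ) * d - c * b) * w.im / Complex.normSq (dimCharge w a b) := by
  rw [Complex.div_im, dimCharge_im, dimCharge_re, dimCharge_im, dimCharge_re]
  ring

lemma sin_arg_sub {x y : ℂ} (hx : x ≠ 0) (hy : y ≠ 0) :
    Real.sin (Complex.arg x - Complex.arg y) = (x / y).im * ‖y‖ / ‖x‖ := by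
  have hx' := norm_ne_zero_iff.2 hx
  have hy' := norm_ne_zero_iff.2 hy
  rw [Real.sin_sub, Complex.sin_arg, Complex.cos_arg hx, Complex.sin_arg, Complex.cos_arg hy,
    Complex.div_im, Complex.normSq_eq_norm_sq]
  field_simp

/-- The case of charges on opposite sides of the real axis. The difference of the arguments lies
between 0 and 2π, and its sine has the sign of the determinant ad - cb > 0, so it is less than π. -/
lemma abs_arg_dimCharge_sub_lt_aux (hw : 0 < w.im) (h : 0 < a + b) (h' : 0 < c + d) (hab : b < a)
    (hcd : c ≤ d) :
    |Complex.arg (dimCharge w c d) - Complex.arg (dimCharge w a b)| < Real.pi := by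
  have h1 := (arg_dimCharge_nonneg_iff (a := c) (b := d) hw).2 hcd
  have h2 : Complex.arg (dimCharge w a b) < 0 :=
    not_le.1 fun h0 => absurd ((arg_dimCharge_nonneg_iff hw).1 h0) (by omega)
  have h3 := arg_dimCharge_lt_pi (a := c) (b := d) hw
  have h4 := Complex.neg_pi_lt_arg (dimCharge w a b)
  have hz := dimCharge_ne_zero hw h
  have hz' := dimCharge_ne_zero hw h'
  have h5 : 0 < Real.sin (Complex.arg (dimCharge w c d) - Complex.arg (dimCharge w a b)) := by
    rw [sin_arg_sub hz' hz, dimCharge_cross]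
    have h6 : 0 < (a : ℝ) * d - c * b := by
      have : c * b < a * d := by nlinarith
      rw [sub_pos]
      exact_mod_cast this
    have := Complex.normSq_pos.2 hz
    positivity
  rw [abs_lt]
  refine ⟨by linarith, ?_⟩
  by_contra h6
  have h7 := Real.sin_nonpos_of_nonpos_of_neg_pi_le
    (x := Complex.arg (dimCharge w c d) - Complex.arg (dimCharge w a b) - 2 * Real.pi)
    (by linarith) (by linarith)
  rw [Real.sin_sub_two_pi] at h7
  linarith

lemma abs_arg_dimCharge_sub_lt (hw : 0 < w.im) (h : 0 < a + b) (h' : 0 < c + d) :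
    |Complex.arg (dimCharge w c d) - Complex.arg (dimCharge w a b)| < Real.pi := by
  have h1 := arg_dimCharge_lt_pi (a := a) (b := b) hw
  have h2 := arg_dimCharge_lt_pi (a := c) (b := d) hw
  have h3 := Complex.neg_pi_lt_arg (dimCharge w a b)
  have h4 := Complex.neg_pi_lt_arg (dimCharge w c d)
  have i1 := arg_dimCharge_nonneg_iff (a := a) (b := b) hw
  have i2 := arg_dimCharge_nonneg_iff (a := c) (b := d) hw
  rcases lt_or_ge b a with hab | hab <;> rcases lt_or_ge d c with hcd | hcd
  · have := not_le.1 (mt i1.1 (by omega))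
    have := not_le.1 (mt i2.1 (by omega))
    rw [abs_lt]; constructor <;> linarith
  · exact abs_arg_dimCharge_sub_lt_aux hw h h' hab hcd
  · rw [abs_sub_comm]
    exact abs_arg_dimCharge_sub_lt_aux hw h' h hcd hab
  · have := i1.2 hab
    have := i2.2 hcd
    rw [abs_lt]; constructor <;> linarith

/-- As the arguments differ by less than π, their order is the sign of Im(Z'/Z). By
`dimCharge_cross` this is the sign of ad - cb, because Im w > 0. -/
lemma arg_dimCharge_lt_iff (hw : 0 < w.im) (h : 0 < a + b) (h' : 0 < c + d) :
    Complex.arg (dimCharge w a b) < Complex.arg (dimCharge w c d) ↔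
      dimSlope a b < dimSlope c d := by
  have hz := dimCharge_ne_zero hw h
  have hz' := dimCharge_ne_zero hw h'
  have h1 := arg_div_eq_sub hz' hz (abs_arg_dimCharge_sub_lt hw h h')
  have hn := Complex.normSq_pos.2 hz
  have hlt : Complex.arg (dimCharge w a b) < Complex.arg (dimCharge w c d) ↔
      0 < (dimCharge w c d / dimCharge w a b).im := by
    rw [← sub_pos, ← h1]
    have h2 := abs_lt.1 (h1 ▸ abs_arg_dimCharge_sub_lt hw h h')
    have h3 := Complex.norm_mul_sin_arg (dimCharge w c d / dimCharge w a b)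
    have h4 : 0 < ‖dimCharge w c d / dimCharge w a b‖ := norm_pos_iff.2 (div_ne_zero hz' hz)
    constructor
    · intro h5
      rw [← h3]
      exact mul_pos h4 (Real.sin_pos_of_pos_of_lt_pi h5 h2.2)
    · intro h5
      by_contra h6
      have := Real.sin_nonpos_of_nonpos_of_neg_pi_le (not_lt.1 h6) h2.1.le
      nlinarith
  rw [hlt, dimCharge_cross, div_pos_iff_of_pos_right hn, mul_pos_iff_of_pos_right hw, sub_pos,
    dimSlope_lt_iff h h']
  norm_cast
  rw [mul_comm c b, mul_comm a d]

/-- Z'/Z - 1 = (b - a)(w' - w)/Z, and |Z| ≥ |Im Z| = |b - a| Im w. So Z'/Z is near 1 uniformly in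
the dimension vector, and it remains to use continuity of arg and log|·| at 1. -/
lemma dimCharge_continuous (hw : 0 < w.im) {ε : ℝ} (hε : 0 < ε) :
    ∃ δ : ℝ, 0 < δ ∧ ∀ w' : ℂ, 0 < w'.im → ‖w' - w‖ < δ → ∀ a b : ℕ, 0 < a + b →
      |Complex.arg (dimCharge w' a b) - Complex.arg (dimCharge w a b)| < ε ∧
      |Real.log (‖dimCharge w' a b‖ / ‖dimCharge w a b‖)| < ε := by
  have c1 : ContinuousAt Complex.arg 1 := Complex.continuousAt_arg (by simp)
  have c2 : ContinuousAt (fun z : ℂ => Real.log ‖z‖) 1 :=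
    (continuous_norm.continuousAt).log (by simp)
  obtain ⟨η₁, hη₁, H₁⟩ := Metric.continuousAt_iff.1 c1 ε hε
  obtain ⟨η₂, hη₂, H₂⟩ := Metric.continuousAt_iff.1 c2 ε hε
  refine ⟨min η₁ η₂ * w.im, by positivity, fun w' hw' hww a b hab => ?_⟩
  have hz := dimCharge_ne_zero hw hab
  have hz' := dimCharge_ne_zero hw' hab
  have hn := norm_pos_iff.2 hz
  have hdist : dist (dimCharge w' a b / dimCharge w a b) 1 < min η₁ η₂ := by
    have e : dimCharge w' a b / dimCharge w a b - 1 =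
        (((b : ℝ) - a : ℝ) : ℂ) * (w' - w) / dimCharge w a b := by
      rw [div_sub_one hz]
      congr 1
      simp only [dimCharge]
      push_cast
      ring
    rw [dist_eq_norm, e, norm_div, norm_mul, Complex.norm_real, Real.norm_eq_abs, div_lt_iff₀ hn]
    have h1 : |(b : ℝ) - a| * w.im ≤ ‖dimCharge w a b‖ := by
      conv_lhs => rw [← abs_of_pos hw, ← abs_mul, ← dimCharge_im]
      exact Complex.abs_im_le_norm _
    rcases eq_or_ne |(b : ℝ) - a| 0 with h0 | h0
    · rw [h0, zero_mul]
      positivity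
    · have h0' : 0 < |(b : ℝ) - a| := lt_of_le_of_ne (abs_nonneg _) h0.symm
      calc |(b : ℝ) - a| * ‖w' - w‖ < |(b : ℝ) - a| * (min η₁ η₂ * w.im) := by gcongr
        _ = min η₁ η₂ * (|(b : ℝ) - a| * w.im) := by ring
        _ ≤ _ := by gcongr
  -- The sign of b - a decides the half-plane of both charges, so no jump by 2π occurs when the
  -- argument of the quotient is taken.
  have hlt : |Complex.arg (dimCharge w' a b) - Complex.arg (dimCharge w a b)| < Real.pi := by
    have h1 := arg_dimCharge_lt_pi (a := a) (b := b) hw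
    have h2 := arg_dimCharge_lt_pi (a := a) (b := b) hw'
    have h3 := Complex.neg_pi_lt_arg (dimCharge w a b)
    have h4 := Complex.neg_pi_lt_arg (dimCharge w' a b)
    have i1 := arg_dimCharge_nonneg_iff (a := a) (b := b) hw
    have i2 := arg_dimCharge_nonneg_iff (a := a) (b := b) hw'
    rcases lt_or_ge b a with h | h
    · have := not_le.1 (mt i1.1 (by omega))
      have := not_le.1 (mt i2.1 (by omega))
      rw [abs_lt]; constructor <;> linarith
    · have := i1.2 h
      have := i2.2 h
      rw [abs_lt]; constructor <;> linarith
  have k1 := H₁ (hdist.trans_le (min_le_left _ _))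
  have k2 := H₂ (hdist.trans_le (min_le_right _ _))
  rw [Complex.arg_one, dist_zero_right, Real.norm_eq_abs, arg_div_eq_sub hz' hz hlt] at k1
  rw [norm_one, Real.log_one, dist_zero_right, Real.norm_eq_abs, norm_div] at k2
  exact ⟨k1, k2⟩

/-- A triangle with vertices 0, 1, w is determined by its angles at 0 and 1. Explicitly w' = rw and
1 - w' = s(1 - w); the sum of the two has imaginary part 0 and real part 1, so r = s and r = 1. -/
lemma eq_of_arg_eq {w w' : ℂ} (hw : 0 < w.im) (hw' : 0 < w'.im)
    (h₁ : Complex.arg w = Complex.arg w') (h₂ : Complex.arg (1 - w) = Complex.arg (1 - w')) :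
    w = w' := by
  have n0 : w ≠ 0 := fun h => by simp [h] at hw
  have n0' : w' ≠ 0 := fun h => by simp [h] at hw'
  have n1 : 1 - w ≠ 0 := fun h => by
    have := congrArg Complex.im h
    simp at this
    linarith
  have n1' : 1 - w' ≠ 0 := fun h => by
    have := congrArg Complex.im h
    simp at this
    linarith
  rw [Complex.arg_eq_arg_iff n0 n0'] at h₁
  rw [Complex.arg_eq_arg_iff n1 n1'] at h₂
  rw [← Complex.ofReal_div] at h₁ h₂
  set r := ‖w'‖ / ‖w‖
  set s := ‖1 - w'‖ / ‖1 - w‖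
  have i1 := congrArg Complex.im h₁
  have i2 := congrArg Complex.im h₂
  have r1 := congrArg Complex.re h₁
  have r2 := congrArg Complex.re h₂
  simp at i1 i2 r1 r2
  have hrs : r = s := by
    have : (r - s) * w.im = 0 := by linarith
    rcases mul_eq_zero.1 this with h | h
    · linarith
    · exact absurd h hw.ne'
  have hr : r = 1 := by
    rw [← hrs] at r2
    linarith
  rw [hr] at h₁
  simpa using h₁

end Charge

/-! ### The periods -/

namespace A1Branch

/-- Division by 2πi turns the negative real part log|β₀| - log|β₁| into a positive imaginary part.
-/
lemma period₁_im_pos (p : A1Branch) : 0 < p.period₁.im := by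
  have h := p.norm_lt
  rw [← p.exp_logβ₀, ← p.exp_logβ₁, Complex.norm_exp, Complex.norm_exp, Real.exp_lt_exp] at h
  have h2 : p.period₁ = ((p.logβ₀ - p.logβ₁) * (-Complex.I)) / ((2 * Real.pi : ℝ) : ℂ) := by
    have hp : (Real.pi : ℂ) ≠ 0 := by exact_mod_cast Real.pi_ne_zero
    rw [period₁, div_eq_div_iff (by simp [hp]) (by simp [hp])]
    push_cast
    linear_combination ((2 * (Real.pi : ℂ) * (p.logβ₀ - p.logβ₁))) * Complex.I_mul_I
  rw [h2, Complex.div_ofReal_im]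
  have : 0 < ((p.logβ₀ - p.logβ₁) * (-Complex.I)).im := by
    simp
    exact h
  have := Real.pi_pos
  positivity

/-- The polynomial x + W + W² has the roots (±s - 1)/2 with s² = 1 - 4x. For |x| < 1/4 the number s²
has positive real part, so s is not imaginary and can be chosen with Re s > 0, which means |s - 1| <
|s + 1|. -/
lemma exists_branch {x : ℂ} (hx : x ≠ 0) (hx' : ‖x‖ < 1 / 4) : ∃ p : A1Branch, p.x = x := by
  obtain ⟨s, hs⟩ := IsAlgClosed.exists_pow_nat_eq (1 - 4 * x) (n := 2) two_pos
  wlog hre : 0 ≤ s.re generalizing s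
  · exact this (-s) (by rw [neg_sq, hs]) (by simp; linarith)
  have hre' : 0 < s.re := by
    refine lt_of_le_of_ne hre fun h0 => ?_
    have h1 : (s ^ 2).re ≤ 0 := by
      rw [sq, Complex.mul_re, ← h0]
      nlinarith [sq_nonneg s.im]
    rw [hs] at h1
    have h2 := Complex.re_le_norm x
    simp at h1
    linarith
  let β₀ : ℂ := (s - 1) / 2
  let β₁ : ℂ := (-s - 1) / 2
  have hprod : β₀ * β₁ = x := by
    simp only [β₀, β₁]
    linear_combination (-1 / 4 : ℂ) * hs
  have h0 : β₀ ≠ 0 := fun h => hx (by rw [← hprod, h, zero_mul])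
  have h1 : β₁ ≠ 0 := fun h => hx (by rw [← hprod, h, mul_zero])
  refine ⟨{ a₁ := x, a₂ := 1, a₃ := 1, a₂_ne_zero := one_ne_zero, a₃_ne_zero := one_ne_zero
            β₀ := β₀, β₁ := β₁
            roots := fun W => ?_
            logβ₀ := Complex.log β₀, logβ₁ := Complex.log β₁
            exp_logβ₀ := Complex.exp_log h0, exp_logβ₁ := Complex.exp_log h1
            norm_lt := ?_ }, by simp [A1Branch.x]⟩
  · rw [← hprod]
    simp only [β₀, β₁]
    ring
  · simp only [β₀, β₁, norm_div]
    gcongr ?_ / _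
    · simp
    rw [← sq_lt_sq₀ (norm_nonneg _) (norm_nonneg _), ← Complex.normSq_eq_norm_sq,
      ← Complex.normSq_eq_norm_sq, Complex.normSq_apply, Complex.normSq_apply]
    simp
    nlinarith

end A1Branch

/-! ### Classes in the Grothendieck group and the charge of a period -/

section K0

variable {C : Type u} [Category.{v} C] [Preadditive C] [HasZeroObject C] [HasShift C ℤ]
  [∀ n : ℤ, (shiftFunctor C n).Additive] [Pretriangulated C]

lemma ExistsTriangle.k0Class_eq {X Y Z : C} (h : ExistsTriangle X Y Z) :
    k0Class Y = k0Class X + k0Class Z := by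
  obtain ⟨f, g, k, hT⟩ := h
  have h1 := (QuotientAddGroup.eq_zero_iff _).2
    (AddSubgroup.subset_closure (k := {x : FreeAbelianGroup C | ∃ T ∈ distTriang C,
      x = FreeAbelianGroup.of T.obj₂ - (FreeAbelianGroup.of T.obj₁ + FreeAbelianGroup.of T.obj₃)})
      ⟨_, hT, rfl⟩)
  exact sub_eq_zero.1 h1

lemma k0Class_isZero {X : C} (hX : IsZero X) : k0Class X = 0 := by
  have h : ExistsTriangle X X (0 : C) := .of_mem (contractible_distinguished X)
  simpa using (h.of_iso (Iso.refl X) (Iso.refl X) (hX.isoZero.symm)).k0Class_eq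

lemma k0Class_iso {X Y : C} (e : X ≅ Y) : k0Class X = k0Class Y := by
  have h : ExistsTriangle X X (0 : C) := .of_mem (contractible_distinguished X)
  have h' := (h.of_iso (Iso.refl X) e (Iso.refl _)).k0Class_eq
  rw [k0Class_isZero (isZero_zero C), add_zero] at h'
  exact h'.symm

end K0

namespace DoubledKronecker

/-- Dévissage: a simple subrepresentation is split off, and induction on the total dimension applies
to the quotient. -/
lemma additive_eq_dim {G : Type*} [AddCommGroup G] (F : NilRep → G)
    (h₀ : ∀ M, IsZero M → F M = 0)
    (hF : ∀ S : ShortComplex NilRep, S.ShortExact → F S.X₂ = F S.X₁ + F S.X₃) (M : NilRep) :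
    F M = dim Vertex.s M • F (simple Vertex.s) + dim Vertex.t M • F (simple Vertex.t) := by
  classical
  induction h : dim Vertex.s M + dim Vertex.t M using Nat.strong_induction_on generalizing M with
  | _ n ih =>
    by_cases hM : IsZero M
    · rw [h₀ M hM, dim_of_isZero _ hM, dim_of_isZero _ hM, zero_smul, zero_smul, add_zero]
    · obtain ⟨v, f, hf⟩ := exists_mono_simple hM
      have hs := dim_of_mono Vertex.s f
      have ht := dim_of_mono Vertex.t f
      have hS := hF (ShortComplex.mk f (cokernel.π f) (by simp))
        { exact := ShortComplex.exact_of_g_is_cokernel _ (cokernelIsCokernel f) }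
      rw [dim_simple] at hs ht
      have hc := ih (dim Vertex.s (cokernel f) + dim Vertex.t (cokernel f))
        (by cases v <;> simp at hs ht <;> omega) (cokernel f) rfl
      dsimp only at hS
      rw [hS, hc, hs, ht]
      cases v <;> simp [add_smul] <;> abel

/-- The central charge of a representation for the period `w`. -/
noncomputable def repCharge (w : ℂ) (M : NilRep) : ℂ :=
  dimCharge w (dim Vertex.s M) (dim Vertex.t M)

lemma repCharge_simple_s (w : ℂ) : repCharge w (simple Vertex.s) = 1 - w := by
  classical
  simp [repCharge, dimCharge, dim_simple]

lemma repCharge_simple_t (w : ℂ) : repCharge w (simple Vertex.t) = w := by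
  classical
  simp [repCharge, dimCharge, dim_simple]

lemma repCharge_reverseObj (w : ℂ) : repCharge w reverseObj = 1 := by
  simp [repCharge, dimCharge, dim_reverseObj]

lemma repCharge_pointObj (w : ℂ) (y : ℂ × ℂ) : repCharge w (pointObj y) = 1 := by
  simp [repCharge, dimCharge, dim_pointObj]

lemma repCharge_iso (w : ℂ) {M N : NilRep} (e : M ≅ N) : repCharge w M = repCharge w N := by
  rw [repCharge, repCharge, dim_iso _ e, dim_iso _ e]

lemma repCharge_of_shortExact (w : ℂ) {S : ShortComplex NilRep} (hS : S.ShortExact) :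
    repCharge w S.X₂ = repCharge w S.X₁ + repCharge w S.X₃ := by
  simp only [repCharge, dimCharge, dim_of_shortExact _ hS]
  push_cast
  ring

lemma repCharge_ne_zero {w : ℂ} (hw : 0 < w.im) {M : NilRep} (hM : ¬ IsZero M) :
    repCharge w M ≠ 0 := dimCharge_ne_zero hw (dim_pos hM)

lemma abs_arg_repCharge_sub_lt {w : ℂ} (hw : 0 < w.im) {M N : NilRep} (hM : ¬ IsZero M)
    (hN : ¬ IsZero N) :
    |Complex.arg (repCharge w M) - Complex.arg (repCharge w N)| < Real.pi :=
  abs_arg_dimCharge_sub_lt hw (dim_pos hN) (dim_pos hM)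

lemma arg_repCharge_lt_iff {w : ℂ} (hw : 0 < w.im) {M N : NilRep} (hM : ¬ IsZero M)
    (hN : ¬ IsZero N) :
    Complex.arg (repCharge w M) < Complex.arg (repCharge w N) ↔ slope M < slope N :=
  arg_dimCharge_lt_iff hw (dim_pos hM) (dim_pos hN)

/-- S_t has charge w and the largest possible slope, so arg w is the right end of the interval. -/
lemma arg_repCharge_mem {w : ℂ} (hw : 0 < w.im) {M : NilRep} (hM : ¬ IsZero M) :
    Complex.arg (repCharge w M) ∈
      Set.Ioc (Complex.arg w - Real.pi) (Complex.arg w - Real.pi + Real.pi) := by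
  have h : dimCharge w 0 1 = w := by simp [dimCharge]
  have h₁ := abs_arg_dimCharge_sub_lt hw one_pos (dim_pos hM) (a := 0) (b := 1)
  have h₂ := arg_dimCharge_lt_iff hw (a := 0) (b := 1) one_pos (dim_pos hM)
  rw [h, dimSlope_lt_iff one_pos (dim_pos hM), mul_zero] at h₂
  rw [h, abs_lt] at h₁
  rw [sub_add_cancel]
  exact ⟨by rw [repCharge]; linarith, not_lt.1 (mt h₂.1 (Nat.not_lt_zero _))⟩

section Heart

variable {C : Type u} [Category.{v} C] [Preadditive C] [HasZeroObject C] [HasShift C ℤ]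
  [∀ n : ℤ, (shiftFunctor C n).Additive] [Pretriangulated C] (t : TStructure C) [t.Heart NilRep]

lemma heart_of_iso {X : C} {M : NilRep} (e : X ≅ t.ιHeart.obj M) : t.heart X :=
  t.heart.prop_of_iso e.symm (t.ιHeart_obj_mem M)

lemma shortExact_of_existsTriangle {A B D : NilRep}
    (h : ExistsTriangle (t.ιHeart.obj A) (t.ιHeart.obj B) (t.ιHeart.obj D)) :
    ∃ (f : A ⟶ B) (g : B ⟶ D) (w : f ≫ g = 0), (ShortComplex.mk f g w).ShortExact := by
  obtain ⟨f, g, k, hT⟩ := h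
  obtain ⟨f, rfl⟩ := t.ιHeart.map_surjective f
  obtain ⟨g, rfl⟩ := t.ιHeart.map_surjective g
  exact ⟨f, g, shortExact_of_triangle t f g k hT⟩

open Classical in
/-- The central charge of an object of the heart. -/
noncomputable def heartCharge (w : ℂ) (X : C) : ℂ :=
  if h : t.heart X then repCharge w (exists_iso_ιHeart (H := NilRep) t h).choose else 0

lemma heartCharge_eq (w : ℂ) {X : C} {M : NilRep} (e : X ≅ t.ιHeart.obj M) :
    heartCharge t w X = repCharge w M := by
  have h := heart_of_iso t e
  rw [heartCharge, dif_pos h]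
  exact repCharge_iso w (t.ιHeart.preimageIso
    ((exists_iso_ιHeart (H := NilRep) t h).choose_spec.some.symm ≪≫ e))

lemma isHeartAdditive_heartCharge (w : ℂ) : IsHeartAdditive t (heartCharge t w) where
  iso {X Y} e := by
    by_cases h : t.heart X
    · obtain ⟨M, ⟨e'⟩⟩ := exists_iso_ιHeart (H := NilRep) t h
      rw [heartCharge_eq t w e', heartCharge_eq t w (e.symm ≪≫ e')]
    · have h' : ¬ t.heart Y := fun h' => h (t.heart.prop_of_iso e.symm h')
      rw [heartCharge, heartCharge, dif_neg h, dif_neg h']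
  add {X Y Z} h hX hY hZ := by
    obtain ⟨A, ⟨a⟩⟩ := exists_iso_ιHeart (H := NilRep) t hX
    obtain ⟨B, ⟨b⟩⟩ := exists_iso_ιHeart (H := NilRep) t hY
    obtain ⟨D, ⟨d⟩⟩ := exists_iso_ιHeart (H := NilRep) t hZ
    obtain ⟨f, g, w', hS⟩ := shortExact_of_existsTriangle t (h.of_iso a b d)
    rw [heartCharge_eq t w a, heartCharge_eq t w b, heartCharge_eq t w d]
    have h' := repCharge_of_shortExact w hS
    dsimp only at h'
    exact h'

variable [IsTriangulated C]

lemma exists_charge (hb : ∀ X, t.bounded X) (w : ℂ) :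
    ∃ Z : TriangulatedK0 C →+ ℂ, ∀ (X : C) (M : NilRep), (X ≅ t.ιHeart.obj M) →
      Z (k0Class X) = repCharge w M := by
  obtain ⟨Z, hZ⟩ := (isHeartAdditive_heartCharge t w).exists_hom hb
  exact ⟨Z, fun X M e => (hZ X (heart_of_iso t e)).trans (heartCharge_eq t w e)⟩

/-- The representations `R_y` as objects of the heart. -/
def pointProperty (y : ℂ × ℂ) : ObjectProperty C := fun X =>
  Nonempty (X ≅ t.ιHeart.obj (pointObj y))

/-- The simple representation at `t` as an object of the heart. -/
def lineProperty : ObjectProperty C := fun X => Nonempty (X ≅ t.ιHeart.obj (simple Vertex.t))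

/-- The two prescribed values determine the charge on the whole heart, since Z(S_s) = Z(R_y) -
Z(S_t) = 1 - w. -/
lemma isA1Charge_iff (p : A1Branch) (Z : TriangulatedK0 C →+ ℂ) :
    IsA1Charge (pointProperty t) (lineProperty t) p Z ↔
      ∀ (X : C) (M : NilRep), (X ≅ t.ιHeart.obj M) → Z (k0Class X) = repCharge p.period₁ M := by
  constructor
  · rintro ⟨h₁, h₂⟩ X M e
    have hF := additive_eq_dim (fun M => Z (k0Class (t.ιHeart.obj M)))
      (fun M hM => by rw [k0Class_isZero ((t.ιHeart (H := NilRep)).map_isZero hM), map_zero])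
      (fun S hS => by
        obtain ⟨δ, hT⟩ := exists_triangle_of_shortExact t hS
        rw [← map_add, ← ExistsTriangle.k0Class_eq ⟨_, _, _, hT⟩])
    -- One point suffices, because all R_y have the same dimension vector.
    have hp := h₁ (1, 0) (by simp) _ ⟨Iso.refl _⟩
    have hl := h₂ _ ⟨Iso.refl _⟩
    have hp' := hF (pointObj (1, 0))
    have hM := hF M
    rw [hp, hl, dim_pointObj, dim_pointObj, one_smul, one_smul, A1Branch.period₀] at hp'
    rw [hl] at hM
    rw [k0Class_iso e]
    refine hM.trans ?_
    rw [repCharge, dimCharge, nsmul_eq_mul, nsmul_eq_mul]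
    linear_combination (-(dim Vertex.s M : ℂ)) * hp'
  · intro h
    refine ⟨fun y _ X ⟨e⟩ => ?_, fun X ⟨e⟩ => ?_⟩
    · rw [h X _ e, repCharge_pointObj, A1Branch.period₀]
    · rw [h X _ e, repCharge_simple_t]

end Heart

end DoubledKronecker

/-! ### Operations on Harder-Narasimhan filtrations -/

section Filtration

variable {C : Type u} [Category.{v} C] [Preadditive C] [HasZeroObject C] [HasShift C ℤ]
  [∀ n : ℤ, (shiftFunctor C n).Additive] [Pretriangulated C] {t : TStructure C}
  {ss : ObjectProperty C} {ph : C → ℝ}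

namespace HNFiltration

/-- The filtration of length zero of a zero object. -/
def nil {E : C} (hE : IsZero E) (hE' : t.heart E) : HNFiltration t ss ph E where
  length := 0
  F _ := E
  factor _ := E
  F_zero := rfl
  isZero_F_length := hE
  heart_F _ _ := hE'
  semistable_factor _ h := absurd h (Nat.not_lt_zero _)
  shortExact _ h := absurd h (Nat.not_lt_zero _)
  phase_lt _ h := absurd h (Nat.not_lt_zero _)

/-- Extension of a filtration by a semistable quotient of smaller phase. -/
def cons {E' E Q : C} (F : HNFiltration t ss ph E') (hE : t.heart E) (hQ : ss Q)
    (h : ExistsTriangle E' E Q) (hlt : 0 < F.length → ph Q < ph (F.factor 0)) :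
    HNFiltration t ss ph E where
  length := F.length + 1
  F i := Nat.casesOn i E F.F
  factor i := Nat.casesOn i Q F.factor
  F_zero := rfl
  isZero_F_length := F.isZero_F_length
  heart_F i hi := match i with
    | 0 => hE
    | i + 1 => F.heart_F i (by omega)
  semistable_factor i hi := match i with
    | 0 => hQ
    | i + 1 => F.semistable_factor i (by omega)
  shortExact i hi := match i with
    | 0 => by
      have h' := h
      rw [← F.F_zero] at h'
      exact h'
    | i + 1 => F.shortExact i (by omega)
  phase_lt i hi := match i with
    | 0 => hlt (by omega)
    | i + 1 => F.phase_lt i (by omega)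

/-- The induced filtration of the first step. -/
def tail {E : C} (F : HNFiltration t ss ph E) (h : 0 < F.length) :
    HNFiltration t ss ph (F.F 1) where
  length := F.length - 1
  F i := F.F (i + 1)
  factor i := F.factor (i + 1)
  F_zero := rfl
  isZero_F_length := by
    rw [Nat.sub_add_cancel h]
    exact F.isZero_F_length
  heart_F i hi := F.heart_F (i + 1) (by omega)
  semistable_factor i hi := F.semistable_factor (i + 1) (by omega)
  shortExact i hi := F.shortExact (i + 1) (by omega)
  phase_lt i hi := F.phase_lt (i + 1) (by omega)

lemma existsTriangle {E : C} (F : HNFiltration t ss ph E) (h : 0 < F.length) :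
    ExistsTriangle (F.F 1) E (F.factor 0) := by
  have h' : ExistsTriangle (F.F 1) (F.F 0) (F.factor 0) := F.shortExact 0 h
  rwa [F.F_zero] at h'

lemma length_pos {E : C} (F : HNFiltration t ss ph E) (hE : ¬ IsZero E) : 0 < F.length := by
  refine Nat.pos_of_ne_zero fun h => hE ?_
  have := F.isZero_F_length
  rwa [h, F.F_zero] at this

end HNFiltration

lemma ExistsTriangle.nonempty_iso {X Y Z : C} (h : ExistsTriangle X Y Z) (hX : IsZero X) :
    Nonempty (Y ≅ Z) := by
  obtain ⟨f, g, k, hT⟩ := h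
  have : IsIso g := (Triangle.isZero₁_iff_isIso₂ _ hT).1 hX
  exact ⟨asIso g⟩

end Filtration

/-! ### Existence of the family of stability conditions -/

namespace DoubledKronecker

variable {C : Type u} [Category.{v} C] [Preadditive C] [HasZeroObject C] [HasShift C ℤ]
  [∀ n : ℤ, (shiftFunctor C n).Additive] [Pretriangulated C] (t : TStructure C) [t.Heart NilRep]

/-- The objects of the heart that correspond to slope semistable representations. -/
def heartSemistable : ObjectProperty C := fun X =>
  ∃ M : NilRep, IsSlopeSemistable M ∧ Nonempty (X ≅ t.ιHeart.obj M)

lemma isZero_ιHeart_iff (M : NilRep) : IsZero (t.ιHeart.obj M) ↔ IsZero M :=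
  ⟨fun h => by
    rw [IsZero.iff_id_eq_zero] at h ⊢
    exact t.ιHeart.map_injective (by rw [CategoryTheory.Functor.map_id, h, Functor.map_zero]),
    t.ιHeart.map_isZero⟩

lemma slope_lt_of_shortExact {A B D : NilRep} {f : A ⟶ B} {g : B ⟶ D} {w : f ≫ g = 0}
    (h : (ShortComplex.mk f g w).ShortExact) (hA : ¬ IsZero A) (hD : ¬ IsZero D)
    (hlt : slope D < slope A) : slope D < slope B := by
  have hs := dim_of_shortExact Vertex.s h
  have ht := dim_of_shortExact Vertex.t h
  dsimp only at hs ht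
  have hB : ¬ IsZero B := fun hB => by
    have := isZero_iff_dim.1 hB
    have := dim_pos hA
    omega
  rw [slope_lt_iff hD hA] at hlt
  rw [slope_lt_iff hD hB, hs, ht]
  nlinarith

section

variable {t} {ss : ObjectProperty C} {ph : C → ℝ}

/-- The outermost factor has the least phase, hence the least slope. Induction on the length bounds
the slope of the first step `F.F 1` below by that of its own outermost factor, so the extension `E`
has slope strictly above that of `Q` as soon as there are two factors. -/
lemma slope_factor_zero_le (hh : ∀ X, ss X → t.heart X)
    (hss : ∀ X, ss X → ∀ M : NilRep, (X ≅ t.ιHeart.obj M) → ¬ IsZero M)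
    (hph : ∀ X Y, ss X → ss Y → ∀ M N : NilRep, (X ≅ t.ιHeart.obj M) → (Y ≅ t.ιHeart.obj N) →
      ph X < ph Y → slope M < slope N)
    (n : ℕ) {X : C} (F : HNFiltration t ss ph X) (hn : F.length = n + 1) {E Q : NilRep}
    (e : X ≅ t.ιHeart.obj E) (q : F.factor 0 ≅ t.ιHeart.obj Q) :
    slope Q ≤ slope E ∧ (0 < n → slope Q < slope E) := by
  induction n generalizing X E Q with
  | zero =>
    have hz : IsZero (F.F 1) := by
      have := F.isZero_F_length
      rwa [hn] at this
    obtain ⟨i⟩ := (F.existsTriangle (by omega)).nonempty_iso hz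
    have j : E ≅ Q := t.ιHeart.preimageIso (e.symm ≪≫ i ≪≫ q)
    refine ⟨le_of_eq ?_, fun h => absurd h (lt_irrefl 0)⟩
    rw [slope, slope, dim_iso _ j, dim_iso _ j]
  | succ n ih =>
    have hpos : 0 < F.length := by omega
    obtain ⟨A, ⟨a⟩⟩ := exists_iso_ιHeart (H := NilRep) t (F.heart_F 1 (by omega))
    have hs₀ := F.semistable_factor 0 (by omega)
    have hs₁ := F.semistable_factor 1 (by omega)
    obtain ⟨R, ⟨r⟩⟩ := exists_iso_ιHeart (H := NilRep) t (hh _ hs₁)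
    -- The first step is nonzero because it surjects onto the next factor.
    have hA : ¬ IsZero A := fun hA => by
      have hz : IsZero (F.F 1) := (t.ιHeart.map_isZero hA).of_iso a
      obtain ⟨f, g, w, hS⟩ := shortExact_of_existsTriangle t
        (((F.tail hpos).existsTriangle (by change 0 < F.length - 1; omega)).of_iso
          (exists_iso_ιHeart (H := NilRep) t (F.heart_F 2 (by omega))).choose_spec.some a r)
      have := hS.epi_g
      exact hss _ hs₁ R r (IsZero.of_epi g hA)
    have h₁ := (ih (F.tail hpos) (by change F.length - 1 = _; omega) a r).1
    have h₂ := (hph _ _ hs₀ hs₁ _ _ q r (F.phase_lt 0 (by omega))).trans_le h₁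
    obtain ⟨f, g, w, hS⟩ := shortExact_of_existsTriangle t ((F.existsTriangle hpos).of_iso a e q)
    have h₃ := slope_lt_of_shortExact hS hA (hss _ hs₀ Q q) h₂
    exact ⟨h₃.le, fun _ => h₃⟩

end

variable [IsTriangulated C]

/-- The extra information that the outermost factor is a quotient of `E` carries the induction:
applied to the kernel of the destabilizing quotient, it gives the strict inequality of slopes
between consecutive factors. -/
lemma exists_filtration {ph : C → ℝ}
    (hph : ∀ M N : NilRep, IsSlopeSemistable M → IsSlopeSemistable N → slope M < slope N →
      ph (t.ιHeart.obj M) < ph (t.ιHeart.obj N)) (E : NilRep) {X : C} (e : X ≅ t.ιHeart.obj E) :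
    ∃ F : HNFiltration t (heartSemistable t) ph X, 0 < F.length →
      ∃ (P : NilRep) (h : E ⟶ P), Epi h ∧ IsSlopeSemistable P ∧
        F.factor 0 = t.ιHeart.obj P := by
  induction hd : dim Vertex.s E + dim Vertex.t E using Nat.strong_induction_on
    generalizing E X with
  | _ n ih =>
    by_cases hE : IsZero E
    · exact ⟨.nil ((t.ιHeart.map_isZero hE).of_iso e) (heart_of_iso t e),
        fun h => absurd h (lt_irrefl 0)⟩
    · obtain ⟨Q, g, hg, hQ, hgQ⟩ := exists_destabilizing_quotient hE
      have hs := dim_of_epi Vertex.s g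
      have ht := dim_of_epi Vertex.t g
      have hpos := dim_pos hQ.1
      obtain ⟨F, hF⟩ := ih (dim Vertex.s (kernel g) + dim Vertex.t (kernel g)) (by omega)
        (kernel g) (Iso.refl _) rfl
      obtain ⟨δ, hT⟩ := exists_triangle_of_shortExact t
        (S := ShortComplex.mk (kernel.ι g) g (by simp))
        { exact := ShortComplex.exact_of_f_is_kernel _ (kernelIsKernel g) }
      have hT' : ExistsTriangle _ _ _ := ⟨_, _, _, hT⟩
      refine ⟨F.cons (heart_of_iso t e) ⟨Q, hQ, ⟨Iso.refl _⟩⟩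
        (hT'.of_iso (Iso.refl _) e.symm (Iso.refl _)) fun hl => ?_, fun _ => ⟨Q, g, hg, hQ, rfl⟩⟩
      obtain ⟨P, h, hh, hP, hFP⟩ := hF hl
      rw [hFP]
      exact hph Q P hQ hP (hgQ h hh hP.1)

/-- The stability condition on the heart with period `w`. -/
noncomputable def stabilityOfPeriod (hb : ∀ X, t.bounded X) {w : ℂ} (hw : 0 < w.im) :
    StabilityCondition t where
  Z := (exists_charge t hb w).choose
  semistable := heartSemistable t
  phase X := Complex.arg ((exists_charge t hb w).choose (k0Class X))
  semistable_of_iso e := fun ⟨M, hM, ⟨e'⟩⟩ => ⟨M, hM, ⟨e.symm ≪≫ e'⟩⟩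
  heart_of_semistable Q := fun ⟨_, _, ⟨e⟩⟩ => heart_of_iso t e
  charge Q := fun ⟨M, hM, ⟨e⟩⟩ => by
    rw [(exists_charge t hb w).choose_spec Q M e]
    exact ⟨‖repCharge w M‖, norm_pos_iff.2 (repCharge_ne_zero hw hM.1),
      (Complex.norm_mul_exp_arg_mul_I _).symm⟩
  phase_sub_lt Q Q' := fun ⟨M, hM, ⟨e⟩⟩ ⟨M', hM', ⟨e'⟩⟩ _ => by
    rw [(exists_charge t hb w).choose_spec Q M e, (exists_charge t hb w).choose_spec Q' M' e']
    exact abs_arg_repCharge_sub_lt hw hM.1 hM'.1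
  hom_eq_zero Q' Q := fun ⟨M', hM', ⟨e'⟩⟩ ⟨M, hM, ⟨e⟩⟩ hlt f => by
    rw [(exists_charge t hb w).choose_spec Q M e, (exists_charge t hb w).choose_spec Q' M' e',
      arg_repCharge_lt_iff hw hM.1 hM'.1] at hlt
    have h := hM'.hom_eq_zero hM hlt (t.ιHeart.preimage (e'.inv ≫ f ≫ e.hom))
    have h' := congrArg t.ιHeart.map h
    rw [Functor.map_preimage, Functor.map_zero] at h'
    simpa using h'
  hn E hE _ := by
    obtain ⟨M, ⟨e⟩⟩ := exists_iso_ιHeart (H := NilRep) t hE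
    obtain ⟨F, _⟩ := exists_filtration t
      (ph := fun X => Complex.arg ((exists_charge t hb w).choose (k0Class X)))
      (fun M N hM hN h => by
        rw [(exists_charge t hb w).choose_spec _ M (Iso.refl _),
          (exists_charge t hb w).choose_spec _ N (Iso.refl _)]
        exact (arg_repCharge_lt_iff hw hM.1 hN.1).2 h) M e
    exact ⟨F⟩

lemma stabilityOfPeriod_Z (hb : ∀ X, t.bounded X) {w : ℂ} (hw : 0 < w.im) {X : C} {M : NilRep}
    (e : X ≅ t.ιHeart.obj M) : (stabilityOfPeriod t hb hw).Z (k0Class X) = repCharge w M :=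
  (exists_charge t hb w).choose_spec X M e

lemma stabilityOfPeriod_phase (hb : ∀ X, t.bounded X) {w : ℂ} (hw : 0 < w.im) (X : C) :
    (stabilityOfPeriod t hb hw).phase X =
      Complex.arg ((stabilityOfPeriod t hb hw).Z (k0Class X)) := rfl

lemma isBridgeland_stabilityOfPeriod (hb : ∀ X, t.bounded X) {w : ℂ} (hw : 0 < w.im) :
    (stabilityOfPeriod t hb hw).IsBridgeland := by
  refine ⟨Complex.arg w - Real.pi, ?_⟩
  rintro Q ⟨M, hM, ⟨e⟩⟩
  rw [stabilityOfPeriod_phase, stabilityOfPeriod_Z t hb hw e]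
  exact arg_repCharge_mem hw hM.1

lemma exists_family (hb : ∀ X, t.bounded X) : ∃ σ : A1Branch → StabilityCondition t,
    (∀ p, (σ p).IsBridgeland ∧ IsA1Charge (pointProperty t) (lineProperty t) p (σ p).Z ∧
      ∀ Q, (σ p).semistable Q → (σ p).phase Q = Complex.arg ((σ p).Z (k0Class Q))) ∧
    ∀ (p : A1Branch) (ε : ℝ), 0 < ε → ∃ δ : ℝ, 0 < δ ∧ ∀ p' : A1Branch,
      ‖p'.period₁ - p.period₁‖ < δ → ∀ Q, (σ p).semistable Q →
        |(σ p').phase Q - (σ p).phase Q| < ε ∧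
        |Real.log (‖(σ p').Z (k0Class Q)‖ / ‖(σ p).Z (k0Class Q)‖)| < ε := by
  refine ⟨fun p => stabilityOfPeriod t hb p.period₁_im_pos, fun p =>
    ⟨isBridgeland_stabilityOfPeriod t hb _, (isA1Charge_iff t p _).2 fun X M e =>
      stabilityOfPeriod_Z t hb _ e, fun Q _ => rfl⟩, fun p ε hε => ?_⟩
  obtain ⟨δ, hδ, H⟩ := dimCharge_continuous p.period₁_im_pos hε
  refine ⟨δ, hδ, fun p' hp' => ?_⟩
  rintro Q ⟨M, hM, ⟨e⟩⟩
  dsimp only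
  rw [stabilityOfPeriod_phase, stabilityOfPeriod_phase, stabilityOfPeriod_Z t hb _ e,
    stabilityOfPeriod_Z t hb _ e]
  exact H _ p'.period₁_im_pos hp' _ _ (dim_pos hM.1)

end DoubledKronecker

/-! ### Tilted hearts determine the phases -/

section Tilt

variable {C : Type u} [Category.{v} C] [Preadditive C] [HasZeroObject C] [HasShift C ℤ]
  [∀ n : ℤ, (shiftFunctor C n).Additive] [Pretriangulated C]

lemma ExtensionClosure.hom_eq_zero_right {P : ObjectProperty C} {A : C}
    (h : ∀ Y, P Y → ∀ f : A ⟶ Y, f = 0) {Y : C} (hY : ExtensionClosure P Y) (f : A ⟶ Y) :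
    f = 0 := by
  induction hY with
  | zero Y hY => exact hY.eq_of_tgt _ _
  | of Y hY => exact h Y hY f
  | extension T hT _ _ ih₁ ih₃ =>
    obtain ⟨g, rfl⟩ := Triangle.coyoneda_exact₂ _ hT f (ih₃ _)
    rw [ih₁ g, zero_comp]

lemma ExtensionClosure.shift_hom_eq_zero_left {P : ObjectProperty C} {B : C} (n : ℤ)
    (h : ∀ X, P X → ∀ f : X⟦n⟧ ⟶ B, f = 0) {X : C} (hX : ExtensionClosure P X)
    (f : X⟦n⟧ ⟶ B) : f = 0 := by
  induction hX with
  | zero X hX => exact ((shiftFunctor C n).map_isZero hX).eq_of_src _ _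
  | of X hX => exact h X hX f
  | extension T hT _ _ ih₁ ih₃ =>
    obtain ⟨g, hg⟩ := Triangle.yoneda_exact₂ _ (Triangle.shift_distinguished _ hT n) f (ih₁ _)
    rw [hg, show g = 0 from ih₃ g]
    exact comp_zero

namespace StabilityCondition

variable {t : TStructure C} (σ : StabilityCondition t)

lemma not_isZero {Q : C} (hQ : σ.semistable Q) : ¬ IsZero Q := fun h => by
  obtain ⟨m, hm, h'⟩ := σ.charge Q hQ
  rw [k0Class_isZero h, map_zero] at h'
  have : (m : ℂ) ≠ 0 := by exact_mod_cast hm.ne'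
  exact mul_ne_zero this (Complex.exp_ne_zero _) h'.symm

lemma isLE_of_semistable {Q : C} (hQ : σ.semistable Q) : t.IsLE Q 0 :=
  ((t.mem_heart_iff Q).1 (σ.heart_of_semistable Q hQ)).1

lemma isGE_of_semistable {Q : C} (hQ : σ.semistable Q) : t.IsGE Q 0 :=
  ((t.mem_heart_iff Q).1 (σ.heart_of_semistable Q hQ)).2

/-- It suffices to treat generators. Degrees exclude all maps except those from X[1] to Q'[1] with
the phase of X above φ and that of Q' at most φ; these vanish by the semistability axiom. -/
lemma tilt_hom_eq_zero (φ : ℝ) {X Y : C} (hX : σ.tilt φ X) (hY : σ.tilt φ Y)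
    (f : X⟦(1 : ℤ)⟧ ⟶ Y) : f = 0 := by
  refine hX.shift_hom_eq_zero_left 1 (fun X hX f => ?_) f
  refine hY.hom_eq_zero_right (fun Y hY f => ?_) f
  have shift_le : ∀ {A : C} (n : ℤ), t.IsLE A n → t.IsLE (A⟦(1 : ℤ)⟧) (n - 1) :=
    fun n _ => t.isLE_shift _ n 1 (n - 1)
  rcases hX with ⟨hX, hφ⟩ | ⟨Q, hQ, hφ, ⟨e⟩⟩
  · rcases hY with ⟨hY, _⟩ | ⟨Q', hQ', hφ', ⟨e'⟩⟩
    · have := shift_le 0 (σ.isLE_of_semistable hX)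
      have := σ.isGE_of_semistable hY
      exact t.zero f (0 - 1) 0
    · have h := σ.hom_eq_zero X Q' hX hQ' (by linarith)
        ((shiftFunctor C (1 : ℤ)).preimage (f ≫ e'.hom))
      have h' := congrArg (shiftFunctor C (1 : ℤ)).map h
      rw [Functor.map_preimage, Functor.map_zero] at h'
      rw [← cancel_mono e'.hom, h', zero_comp]
  · have h₁ : t.IsLE X (0 - 1) :=
      have := shift_le 0 (σ.isLE_of_semistable hQ)
      t.isLE_of_iso e.symm _
    have := shift_le _ h₁
    have : t.IsGE Y (-1) := by
      rcases hY with ⟨hY, _⟩ | ⟨Q', hQ', _, ⟨e'⟩⟩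
      · have := σ.isGE_of_semistable hY
        exact t.isGE_of_ge _ (-1) 0
      · have := σ.isGE_of_semistable hQ'
        have := t.isGE_shift Q' 0 1 (-1)
        exact t.isGE_of_iso e'.symm _
    exact t.zero f (0 - 1 - 1) (-1)

/-- If Q lies in the tilted heart although its phase is at most φ, then Q[1] lies in it too, and the
identity of Q[1] is a map of negative degree, so it is zero. -/
lemma tilt_iff (φ : ℝ) {Q : C} (hQ : σ.semistable Q) : σ.tilt φ Q ↔ φ < σ.phase Q := by
  refine ⟨fun h => ?_, fun h => .of _ (Or.inl ⟨hQ, h⟩)⟩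
  by_contra hφ
  have h' : σ.tilt φ (Q⟦(1 : ℤ)⟧) := .of _ (Or.inr ⟨Q, hQ, not_lt.1 hφ, ⟨Iso.refl _⟩⟩)
  have h₀ := σ.tilt_hom_eq_zero φ h h' (𝟙 _)
  rw [← CategoryTheory.Functor.map_id, ← (shiftFunctor C (1 : ℤ)).map_zero] at h₀
  exact σ.not_isZero hQ ((IsZero.iff_id_eq_zero _).2 ((shiftFunctor C (1 : ℤ)).map_injective h₀))

end StabilityCondition

end Tilt

/-! ### Uniqueness for a given period, and the wall-crossings -/

namespace DoubledKronecker

variable {C : Type u} [Category.{v} C] [Preadditive C] [HasZeroObject C] [HasShift C ℤ]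
  [∀ n : ℤ, (shiftFunctor C n).Additive] [Pretriangulated C] {t : TStructure C} [t.Heart NilRep]

/-- The values of the central charge on the heart are those of the period `w`. -/
def HasPeriod (σ : StabilityCondition t) (w : ℂ) : Prop :=
  ∀ (X : C) (M : NilRep), (X ≅ t.ιHeart.obj M) → σ.Z (k0Class X) = repCharge w M

variable {σ : StabilityCondition t} {w : ℂ}

lemma not_isZero_of_semistable {X : C} (hX : σ.semistable X) {M : NilRep}
    (e : X ≅ t.ιHeart.obj M) : ¬ IsZero M := fun hM =>
  σ.not_isZero hX ((t.ιHeart.map_isZero hM).of_iso e)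

namespace HasPeriod

lemma exists_phase_eq (h : HasPeriod σ w) {X : C} (hX : σ.semistable X) {M : NilRep}
    (e : X ≅ t.ιHeart.obj M) :
    ∃ k : ℤ, σ.phase X = Complex.arg (repCharge w M) + 2 * Real.pi * k := by
  obtain ⟨m, hm, hZ⟩ := σ.charge X hX
  rw [h X M e] at hZ
  have hc : ((Complex.arg (repCharge w M) : ℝ) : Real.Angle) = (σ.phase X : Real.Angle) := by
    rw [hZ, Complex.exp_mul_I]
    have h' := Complex.arg_mul_cos_add_sin_mul_I_coe_angle hm (σ.phase X : Real.Angle)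
    rwa [Real.Angle.cos_coe, Real.Angle.sin_coe, Complex.ofReal_cos, Complex.ofReal_sin] at h'
  obtain ⟨k, hk⟩ := Real.Angle.angle_eq_iff_two_pi_dvd_sub.1 hc.symm
  exact ⟨k, by linarith⟩

/-- Two phases differ by at most π by the Bridgeland condition and two arguments by less than π, so
two values of 2πk differ by less than 2π. -/
lemma exists_phase_eq_uniform (h : HasPeriod σ w) (hw : 0 < w.im) (hσ : σ.IsBridgeland) :
    ∃ k : ℤ, ∀ X, σ.semistable X → ∀ M : NilRep, (X ≅ t.ιHeart.obj M) →
      σ.phase X = Complex.arg (repCharge w M) + 2 * Real.pi * k := by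
  by_cases hne : ∃ X, σ.semistable X
  · obtain ⟨X₀, hX₀⟩ := hne
    obtain ⟨M₀, ⟨e₀⟩⟩ := exists_iso_ιHeart (H := NilRep) t (σ.heart_of_semistable X₀ hX₀)
    obtain ⟨k₀, hk₀⟩ := h.exists_phase_eq hX₀ e₀
    refine ⟨k₀, fun X hX M e => ?_⟩
    obtain ⟨k, hk⟩ := h.exists_phase_eq hX e
    obtain ⟨θ, hθ⟩ := hσ
    have h₁ := hθ X hX
    have h₂ := hθ X₀ hX₀
    have h₃ := abs_lt.1 (abs_arg_repCharge_sub_lt hw (not_isZero_of_semistable hX e)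
      (not_isZero_of_semistable hX₀ e₀))
    have hπ := Real.pi_pos
    have h₄ : k < k₀ + 1 := by
      have : (k : ℝ) < k₀ + 1 := by nlinarith [h₁.2, h₂.1]
      exact_mod_cast this
    have h₅ : k₀ < k + 1 := by
      have : (k₀ : ℝ) < k + 1 := by nlinarith [h₁.1, h₂.2]
      exact_mod_cast this
    rw [hk, show k = k₀ by omega]
  · exact ⟨0, fun X hX => absurd ⟨X, hX⟩ hne⟩

lemma phase_lt_iff (h : HasPeriod σ w) (hw : 0 < w.im) (hσ : σ.IsBridgeland) {X Y : C}
    (hX : σ.semistable X) (hY : σ.semistable Y) {M N : NilRep} (e : X ≅ t.ιHeart.obj M)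
    (e' : Y ≅ t.ιHeart.obj N) : σ.phase X < σ.phase Y ↔ slope M < slope N := by
  obtain ⟨k, hk⟩ := h.exists_phase_eq_uniform hw hσ
  rw [hk X hX M e, hk Y hY N e', add_lt_add_iff_right,
    arg_repCharge_lt_iff hw (not_isZero_of_semistable hX e) (not_isZero_of_semistable hY e')]

lemma factor_slope_le (h : HasPeriod σ w) (hw : 0 < w.im) (hσ : σ.IsBridgeland) {X : C}
    (F : HNFiltration t σ.semistable σ.phase X) (n : ℕ) (hn : F.length = n + 1) {E Q : NilRep}
    (e : X ≅ t.ιHeart.obj E) (q : F.factor 0 ≅ t.ιHeart.obj Q) :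
    slope Q ≤ slope E ∧ (0 < n → slope Q < slope E) :=
  slope_factor_zero_le σ.heart_of_semistable (fun _ hX _ e => not_isZero_of_semistable hX e)
    (fun _ _ hX hY _ _ e e' => (h.phase_lt_iff hw hσ hX hY e e').1) n F hn e q

/-- Both directions use the outermost factor of a Harder-Narasimhan filtration. For semistable X
with a quotient R, the outermost factor of R receives a nonzero map from X, which bounds its slope
and therefore that of R. For a slope semistable object, that factor is a quotient of strictly
smaller slope unless the filtration has length 1. -/
lemma semistable_iff (h : HasPeriod σ w) (hw : 0 < w.im) (hσ : σ.IsBridgeland) (X : C) :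
    σ.semistable X ↔ heartSemistable t X := by
  constructor
  · intro hX
    obtain ⟨M, ⟨e⟩⟩ := exists_iso_ιHeart (H := NilRep) t (σ.heart_of_semistable X hX)
    refine ⟨M, ⟨not_isZero_of_semistable hX e, fun R g hg hR => ?_⟩, ⟨e⟩⟩
    obtain ⟨F⟩ := σ.hn (t.ιHeart.obj R) (t.ιHeart_obj_mem R)
      (fun h => hR ((isZero_ιHeart_iff t R).1 h))
    have hl := F.length_pos (fun h => hR ((isZero_ιHeart_iff t R).1 h))
    have hs := F.semistable_factor 0 hl
    obtain ⟨Q, ⟨q⟩⟩ := exists_iso_ιHeart (H := NilRep) t (σ.heart_of_semistable _ hs)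
    obtain ⟨A, ⟨a⟩⟩ := exists_iso_ιHeart (H := NilRep) t (F.heart_F 1 hl)
    have h₁ := (h.factor_slope_le hw hσ F (F.length - 1) (by omega) (Iso.refl _) q).1
    refine le_trans ?_ h₁
    by_contra hlt
    rw [not_le] at hlt
    obtain ⟨f, p, w', hS⟩ := shortExact_of_existsTriangle t
      ((F.existsTriangle hl).of_iso a (Iso.refl _) q)
    have hp : Epi p := hS.epi_g
    -- The composite epimorphism onto the outermost factor of the quotient would vanish, although
    -- that factor is nonzero.
    have h₂ := σ.hom_eq_zero X (F.factor 0) hX hs ((h.phase_lt_iff hw hσ hs hX q e).2 hlt)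
      (e.hom ≫ t.ιHeart.map (g ≫ p) ≫ q.inv)
    have h₃ : t.ιHeart.map (g ≫ p) = 0 := by
      rw [← cancel_mono q.inv, ← cancel_epi e.hom, h₂, zero_comp, comp_zero]
    have h₄ : g ≫ p = 0 := t.ιHeart.map_injective (by rw [h₃, Functor.map_zero])
    exact not_isZero_of_semistable hs q (IsZero.of_epi_eq_zero (g ≫ p) h₄)
  · rintro ⟨M, hM, ⟨e⟩⟩
    have hX : ¬ IsZero X := fun hX => hM.1 ((isZero_ιHeart_iff t M).1 (hX.of_iso e.symm))
    obtain ⟨F⟩ := σ.hn X (heart_of_iso t e) hX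
    have hl := F.length_pos hX
    have hs := F.semistable_factor 0 hl
    obtain ⟨Q, ⟨q⟩⟩ := exists_iso_ιHeart (H := NilRep) t (σ.heart_of_semistable _ hs)
    have h₁ := (h.factor_slope_le hw hσ F (F.length - 1) (by omega) e q).2
    by_cases hl' : F.length = 1
    · have hz := F.isZero_F_length
      rw [hl'] at hz
      obtain ⟨i⟩ := (F.existsTriangle hl).nonempty_iso hz
      exact σ.semistable_of_iso i.symm hs
    · obtain ⟨A, ⟨a⟩⟩ := exists_iso_ιHeart (H := NilRep) t (F.heart_F 1 hl)
      obtain ⟨f, p, w', hS⟩ := shortExact_of_existsTriangle t ((F.existsTriangle hl).of_iso a e q)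
      exact absurd (h₁ (by omega))
        (not_lt.2 (hM.2 p hS.epi_g (not_isZero_of_semistable hs q)))

lemma semistable_obj (h : HasPeriod σ w) (hw : 0 < w.im) (hσ : σ.IsBridgeland) {M : NilRep}
    (hM : IsSlopeSemistable M) : σ.semistable (t.ιHeart.obj M) :=
  (h.semistable_iff hw hσ _).2 ⟨M, hM, ⟨Iso.refl _⟩⟩

variable {σ' : StabilityCondition t} {w' : ℂ}

/-- The phases of the semistable objects determine the period, even up to a common shift. -/
lemma eq_of_phase_eq_add (h : HasPeriod σ w) (h' : HasPeriod σ' w') (hw : 0 < w.im)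
    (hw' : 0 < w'.im) (hσ : σ.IsBridgeland) (hσ' : σ'.IsBridgeland) (θ : ℝ)
    (hθ : ∀ X, σ.semistable X → σ'.phase X = σ.phase X + θ) : w = w' := by
  obtain ⟨k, hk⟩ := h.exists_phase_eq_uniform hw hσ
  obtain ⟨k', hk'⟩ := h'.exists_phase_eq_uniform hw' hσ'
  have key : ∀ M : NilRep, IsSlopeSemistable M →
      Complex.arg (repCharge w' M) + 2 * Real.pi * k' =
        Complex.arg (repCharge w M) + 2 * Real.pi * k + θ := fun M hM => by
    rw [← hk' _ (h'.semistable_obj hw' hσ' hM) M (Iso.refl _),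
      ← hk _ (h.semistable_obj hw hσ hM) M (Iso.refl _)]
    exact hθ _ (h.semistable_obj hw hσ hM)
  -- The object of charge 1 has argument 0 for both periods, so it absorbs θ and the multiples of
  -- 2π. The other two objects then compare arg w with arg w' and arg(1 - w) with arg(1 - w').
  have h₀ := key _ isSlopeSemistable_reverseObj
  have h₁ := key _ (isSlopeSemistable_simple Vertex.t)
  have h₂ := key _ (isSlopeSemistable_simple Vertex.s)
  rw [repCharge_reverseObj, repCharge_reverseObj] at h₀
  rw [repCharge_simple_t, repCharge_simple_t] at h₁
  rw [repCharge_simple_s, repCharge_simple_s] at h₂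
  exact eq_of_arg_eq hw hw' (by linarith) (by linarith)

lemma wallCrossingSecondKind (h : HasPeriod σ w) (h' : HasPeriod σ' w') (hw : 0 < w.im)
    (hw' : 0 < w'.im) (hσ : σ.IsBridgeland) (hσ' : σ'.IsBridgeland) (hne : w ≠ w') :
    σ.WallCrossingSecondKind σ' := by
  have hss : ∀ Q, σ.semistable Q ↔ σ'.semistable Q := fun Q => by
    rw [h.semistable_iff hw hσ, h'.semistable_iff hw' hσ']
  refine ⟨⟨hss, fun Q₁ Q₂ h₁ h₂ => ?_⟩, ?_⟩
  · obtain ⟨M₁, ⟨e₁⟩⟩ := exists_iso_ιHeart (H := NilRep) t (σ.heart_of_semistable _ h₁)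
    obtain ⟨M₂, ⟨e₂⟩⟩ := exists_iso_ιHeart (H := NilRep) t (σ.heart_of_semistable _ h₂)
    rw [h.phase_lt_iff hw hσ h₁ h₂ e₁ e₂,
      h'.phase_lt_iff hw' hσ' ((hss _).1 h₁) ((hss _).1 h₂) e₁ e₂]
  · obtain ⟨Q, hQ, hQ'⟩ : ∃ Q, σ.semistable Q ∧ σ'.phase Q ≠ σ.phase Q := by
      by_contra! hall
      exact hne (h.eq_of_phase_eq_add h' hw hw' hσ hσ' 0 fun X hX => by rw [hall X hX, add_zero])
    have htilt : ∀ φ, σ.tilt φ = σ'.tilt φ → (φ < σ.phase Q ↔ φ < σ'.phase Q) := fun φ hφ => by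
      rw [← σ.tilt_iff φ hQ, ← σ'.tilt_iff φ ((hss Q).1 hQ), hφ]
    -- Any φ strictly between the two phases serves: Q lies in exactly one of the two tilted hearts.
    refine ⟨(σ.phase Q + σ'.phase Q) / 2, Q, hQ, ?_, fun hφ => ?_⟩
    · rcases lt_or_gt_of_ne hQ' with hlt | hlt
      · exact Or.inr ⟨by linarith, by linarith⟩
      · exact Or.inl ⟨by linarith, by linarith⟩
    · have := htilt _ hφ
      rcases lt_or_gt_of_ne hQ' with hlt | hlt
      · have := this.1 (by linarith)
        linarith
      · have := this.2 (by linarith)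
        linarith

/-- Both charges take the value 1 on `reverseObj`, so the factor would be 1 and the values w and w'
on S_t would agree. -/
lemma not_byDilationRotation (h : HasPeriod σ w) (h' : HasPeriod σ' w') (hne : w ≠ w') :
    ¬ σ.ByDilationRotation σ' := by
  rintro ⟨r, θ, _, H⟩
  have h₁ := H (k0Class (t.ιHeart.obj reverseObj))
  have h₂ := H (k0Class (t.ιHeart.obj (simple Vertex.t)))
  rw [h _ _ (Iso.refl _), h' _ _ (Iso.refl _), repCharge_reverseObj, repCharge_reverseObj,
    mul_one] at h₁
  rw [← h₁, h _ _ (Iso.refl _), h' _ _ (Iso.refl _), repCharge_simple_t, repCharge_simple_t,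
    one_mul] at h₂
  exact hne h₂.symm

/-- By `tilt_iff`, equal tilts up to θ would shift the phases of all semistable objects by θ, and
such phases determine the period. -/
lemma not_sameTiltsUpToRotation (h : HasPeriod σ w) (h' : HasPeriod σ' w') (hw : 0 < w.im)
    (hw' : 0 < w'.im) (hσ : σ.IsBridgeland) (hσ' : σ'.IsBridgeland) (hne : w ≠ w') :
    ¬ σ.SameTiltsUpToRotation σ' := by
  rintro ⟨θ, H⟩
  refine hne (h.eq_of_phase_eq_add h' hw hw' hσ hσ' θ fun Q hQ => ?_)
  have hQ' : σ'.semistable Q := by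
    rwa [h'.semistable_iff hw' hσ', ← h.semistable_iff hw hσ]
  have key : ∀ φ, φ + θ < σ'.phase Q ↔ φ < σ.phase Q := fun φ => by
    rw [← σ.tilt_iff φ hQ, ← σ'.tilt_iff (φ + θ) hQ', H]
  refine le_antisymm ?_ ?_
  · exact not_lt.1 fun hlt => lt_irrefl _ ((key _).1 hlt)
  · by_contra hlt
    have := (key (σ'.phase Q - θ)).2 (by linarith)
    linarith

end HasPeriod

lemma a1WallCrossings [IsTriangulated C] (hb : ∀ X, t.bounded X) :
    A1WallCrossings t (pointProperty t) (lineProperty t) where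
  exists_family := exists_family t hb
  wallCrossing p p' hne σ σ' hσ hσ' hZ hZ' := by
    have h : HasPeriod σ p.period₁ := (isA1Charge_iff t p σ.Z).1 hZ
    have h' : HasPeriod σ' p'.period₁ := (isA1Charge_iff t p' σ'.Z).1 hZ'
    have hw := p.period₁_im_pos
    have hw' := p'.period₁_im_pos
    exact ⟨h.wallCrossingSecondKind h' hw hw' hσ hσ' hne, h.not_byDilationRotation h' hne,
      h.not_sameTiltsUpToRotation h' hw hw' hσ hσ' hne⟩

end DoubledKronecker

/-! ### Transport to the cotangent bundle of the projective line -/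

section Transport

variable {C : Type u} [Category.{v} C] [Preadditive C] [HasZeroObject C] [HasShift C ℤ]
  [∀ n : ℤ, (shiftFunctor C n).Additive] [Pretriangulated C] {t : TStructure C}

lemma A1WallCrossings.of_iff {point point' : ℂ × ℂ → ObjectProperty C}
    {line line' : ObjectProperty C} (h : A1WallCrossings t point line)
    (hp : ∀ y, y ≠ 0 → ∀ X, point y X ↔ point' y X) (hl : ∀ X, line X ↔ line' X) :
    A1WallCrossings t point' line' := by
  have hZ : ∀ p Z, IsA1Charge point line p Z ↔ IsA1Charge point' line' p Z := fun p Z =>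
    and_congr (forall₂_congr fun y hy => forall_congr' fun X => imp_congr_left (hp y hy X))
      (forall_congr' fun X => imp_congr_left (hl X))
  obtain ⟨σ, hσ, hc⟩ := h.exists_family
  exact ⟨⟨σ, fun p => ⟨(hσ p).1, (hZ _ _).1 (hσ p).2.1, (hσ p).2.2⟩, hc⟩,
    fun p p' hne σ σ' h₁ h₂ h₃ h₄ =>
      h.wallCrossing p p' hne σ σ' h₁ h₂ ((hZ _ _).2 h₃) ((hZ _ _).2 h₄)⟩

/-- Translates isomorphism with an object of the heart into isomorphism with the given sheaf in the
ambient derived category, by full faithfulness of the inclusion. -/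
lemma nonempty_iso_iff_of_fullSubcategory {D : Type*} [Category D] {P : ObjectProperty D}
    {X : P.FullSubcategory} {A : D} (e : X.obj ≅ A) (Y : P.FullSubcategory) :
    Nonempty (Y ≅ X) ↔ Nonempty (Y.obj ≅ A) :=
  ⟨fun ⟨i⟩ => ⟨P.ι.mapIso i ≪≫ e⟩, fun ⟨i⟩ => ⟨P.fullyFaithfulι.preimageIso (i ≪≫ e.symm)⟩⟩

end Transport

theorem proposition6p2 :
    (∀ x : ℂ, x ≠ 0 → ‖x‖ < 1 / 4 → ∃ p : A1Branch, p.x = x) ∧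
    (∀ [HasDerivedCategory.{w} A1Geometry.TP1.Modules] (t : TStructure A1Geometry.DbP1.{w})
      [t.Heart DoubledKronecker.NilRep],
      (∀ X, t.bounded X) → A1Geometry.IsStandardHeart t →
        A1WallCrossings t A1Geometry.isSkyscraper A1Geometry.isPushNegOne) ∧
    (∀ (C : Type u) [Category.{v} C] [Preadditive C] [HasZeroObject C] [HasShift C ℤ]
      [∀ n : ℤ, (shiftFunctor C n).Additive] [Pretriangulated C] [IsTriangulated C]
      (t : TStructure C) [t.Heart DoubledKronecker.NilRep],
      (∀ X, t.bounded X) →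
        A1WallCrossings t
          (fun y X => Nonempty (X ≅ t.ιHeart.obj (DoubledKronecker.pointObj y)))
          (fun X => Nonempty
            (X ≅ t.ιHeart.obj (DoubledKronecker.simple DoubledKronecker.Vertex.t)))) := by
  refine ⟨fun x hx hx' => A1Branch.exists_branch hx hx', fun t _ hb ht => ?_,
    fun C _ _ _ _ _ _ _ t _ hb => DoubledKronecker.a1WallCrossings hb⟩
  -- The geometric case is an instance of the abstract one: the standard identification matches S_t
  -- and R_y with the sheaves on which the charge is prescribed.
  obtain ⟨⟨e⟩, _, hy⟩ := ht
  exact (DoubledKronecker.a1WallCrossings hb).of_iff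
    (fun y h X => nonempty_iso_iff_of_fullSubcategory (hy y h).some X)
    (fun X => nonempty_iso_iff_of_fullSubcategory e X)
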